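/- Let $\Phi,\varphi$ be the standard Gaussian distribution function and density, and for a distribution function $G$ let $G^{-1}(t)=\inf\{x: G(x)\ge t\}$. For a real sample $X_1,\dots,X_n$ put $\tilde\beta_1=\bar X=n^{-1}\sum_i X_i$ and $\tilde\beta_2^2=S_n^2=n^{-1}\sum_i (X_i-\bar X)^2$, with $\tilde\beta_2\ge 0$ (the maximum likelihood estimators of mean and variance in the Gaussian model), and let $\hat F_n$ be the empirical distribution function. For $s\ge 0$ let $d(s)=2^{s+1}-1$ and $p_{s,j}=j/2^{s+1}$, $1\le j\le d(s)$. Let $$\rho(p,p)=p(1-p)-\varphi(\Phi^{-1}(p))^2-\tfrac12\,\varphi(\Phi^{-1}(p))^2\,\Phi^{-1}(p)^2,$$ $$\widehat{CC}(p;\tilde\beta)=\frac{p-n^{-1}\sum_{i=1}^n I\{\Phi((X_i-\tilde\beta_1)/\tilde\beta_2)\le p\}}{\sqrt{\rho(p,p)}},\qquad \mathcal P_{d(s)}(\tilde\beta)=n\sum_{j=1}^{d(s)}\widehat{CC}(p_{s,j};\tilde\beta)^2 .$$ Given integers $S(n)\ge 0$, put $D(n)=d(S(n))$, $\mathbb D(n)=\{d(s):0\le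 s\le S(n)\}$, and for $a\ge0$ $$A(a;\tilde\beta)=\min\{d\in\mathbb D(n):\ \mathcal P_{d}(\tilde\beta)-a\,d\ \ge\ \mathcal P_{e}(\tilde\beta)-a\,e\ \text{ for all } e\in\mathbb D(n)\}.$$ Let $\mathcal T_n=n(1-\hat\sigma_n^2/S_n^2)$ with $\hat\sigma_n=\int_0^1\hat F_n^{-1}(t)\Phi^{-1}(t)\,dt$ (the BCMR statistic). Let $\mathbb H$ be the hypothesis that $X_1,\dots,X_n$ are i.i.d. with some Gaussian law of positive variance. For $\alpha\in(0,1)$, the level-$\alpha$ critical value of a statistic $T$ is the smallest $c$ such that $\mathrm{pr}(T>c)\le\alpha$ under every law in $\mathbb H$. Let $t(n,\alpha)$ be that of $\mathcal T_n$, and let $a(n,\alpha)\ge0$, for $n\ge2$, be any number such that $\mathrm{pr}(A(a(n,\alpha);\tilde\beta)=1)\ge1-\alpha$ under every law in $\mathbb H$. Put $$\tilde Q(\alpha)=\begin{cases}A(a(n,\alpha);\tilde\beta)&\text{if }\mathcal T_n\le t(n,\alpha),\\ A(1.5;\tilde\beta)&\text{otherwise,}\end{cases}$$ and let $\tilde c(n,\alpha)$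 be the level-$\alpha$ critical value of $\mathcal P_{\tilde Q(\alpha)}(\tilde\beta)$. **Proposition.** Let $F$ be a distribution function on $\mathbb R$ with finite fourth moment, possessing a bounded density with respect to Lebesgue measure, and with mean $\beta_1(F)$ and standard deviation $\beta_2(F)$. Assume that $F$ is an alternative, that is, $F(x)\ne\Phi((x-\beta_1(F))/\beta_2(F))$ for some $x\in\mathbb R$. Let $S(n)\to\infty$ and $D(n)=o(n^{1/2})$ as $n\to\infty$. Then for every $\alpha\in(0,1)$ the level-$\alpha$ test rejecting for large values of $\mathcal P_{\tilde Q(\alpha)}(\tilde\beta)$ is consistent under $F$: if $X_1,\dots,X_n$ are i.i.d. with distribution function $F$, then $$\mathrm{pr}\big(\mathcal P_{\tilde Q(\alpha)}(\tilde\beta)>\tilde c(n,\alpha)\big)\longrightarrow 1\qquad(n\to\infty).$$ -/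

import Mathlib

open MeasureTheory ProbabilityTheory Filter Topology Asymptotics
open scoped NNReal ENNReal

noncomputable section

namespace GaussianGoF

/-- The standard Gaussian distribution function. -/
def Phi (x : ℝ) : ℝ := cdf (gaussianReal 0 1) x

/-- The standard Gaussian density. -/
def phi (x : ℝ) : ℝ := gaussianPDFReal 0 1 x

/-- The (left-continuous) quantile function of a distribution function `G`. -/
def quantile (G : ℝ → ℝ) (t : ℝ) : ℝ := sInf {x : ℝ | t ≤ G x}

/-! ### Estimators computed from a sample `x` of size `n` -/

/-- The empirical distribution function. -/
def empCDF {n : ℕ} (x : Fin n → ℝ) (y : ℝ) : ℝ :=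
  (n : ℝ)⁻¹ * ∑ i, if x i ≤ y then (1 : ℝ) else 0

/-- The Gaussian maximum likelihood estimator of the expectation: the sample mean. -/
def mean {n : ℕ} (x : Fin n → ℝ) : ℝ := (n : ℝ)⁻¹ * ∑ i, x i

/-- The Gaussian maximum likelihood estimator of the variance (divisor `n`). -/
def sampleVar {n : ℕ} (x : Fin n → ℝ) : ℝ := (n : ℝ)⁻¹ * ∑ i, (x i - mean x) ^ 2

/-- The estimated standard deviation. -/
def sd {n : ℕ} (x : Fin n → ℝ) : ℝ := √(sampleVar x)

/-! ### The grid -/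

/-- The number of grid points at level `s`. -/
def dim (s : ℕ) : ℕ := 2 ^ (s + 1) - 1

/-- The `j`-th grid point, `1 ≤ j ≤ d`, when there are `d` of them. For `d = dim s` this is
`j / 2 ^ (s + 1)`: the dyadic points `(2 k - 1) / 2 ^ (r + 1)`, `r ≤ s`, `1 ≤ k ≤ 2 ^ r`,
in increasing order. -/
def gridPoint (d j : ℕ) : ℝ := (j : ℝ) / ((d : ℝ) + 1)

/-- The dimensions `dim 0, …, dim S` available to the selection rule. -/
def dims (S : ℕ) : Finset ℕ := (Finset.range (S + 1)).image dim

/-! ### The empirical comparison curve and the chi-square type statistics -/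

/-- `ρ₁`, the correction of the covariance due to estimating the expectation. -/
def rho₁ (t : ℝ) : ℝ := phi (quantile Phi t)

/-- `ρ₂`, the correction of the covariance due to estimating the variance. -/
def rho₂ (t : ℝ) : ℝ := (√2)⁻¹ * (phi (quantile Phi t) * quantile Phi t)

/-- The covariance function, under the null model, of the limit of the empirical process with
estimated parameters. -/
def rho (t v : ℝ) : ℝ := min t v - t * v - rho₁ t * rho₁ v - rho₂ t * rho₂ v

/-- The empirical distribution function of the `F₀(xᵢ; β̃) = Φ((xᵢ - β̃₁) / β̃₂)`. -/
def fittedCDF {n : ℕ} (x : Fin n → ℝ) (p : ℝ) : ℝ :=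
  (n : ℝ)⁻¹ * ∑ i, if Phi ((x i - mean x) / sd x) ≤ p then (1 : ℝ) else 0

/-- The empirical comparison curve. -/
def empCC {n : ℕ} (x : Fin n → ℝ) (p : ℝ) : ℝ := (p - fittedCDF x p) / √(rho p p)

/-- The chi-square type statistic with `d` components. -/
def chiSq {n : ℕ} (x : Fin n → ℝ) (d : ℕ) : ℝ :=
  n * ∑ j ∈ Finset.Icc 1 d, empCC x (gridPoint d j) ^ 2

/-! ### The selection rule -/

/-- `A(a)`: the smallest dimension, among those up to level `S`, that maximizes the statistic
penalized by `a` times the dimension. -/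
def selDim {n : ℕ} (S : ℕ) (a : ℝ) (x : Fin n → ℝ) : ℕ :=
  sInf {d : ℕ | d ∈ dims S ∧ ∀ e ∈ dims S, chiSq x e - a * e ≤ chiSq x d - a * d}

/-- The scale estimator `∫₀¹ F̂ₙ⁻¹(t) Φ⁻¹(t) dt`. -/
def bcmrScale {n : ℕ} (x : Fin n → ℝ) : ℝ :=
  ∫ t in (0 : ℝ)..1, quantile (empCDF x) t * quantile Phi t

/-- The oracle statistic `Tₙ` of del Barrio, Cuesta-Albertos, Matrán and Rodríguez-Rodríguez. -/
def bcmr {n : ℕ} (x : Fin n → ℝ) : ℝ := n * (1 - bcmrScale x ^ 2 / sampleVar x)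

/-! ### The composite null hypothesis, critical values and the data driven test -/

/-- The law of an i.i.d. sample of size `n` from `μ`. -/
def sampleLaw (n : ℕ) (μ : Measure ℝ) : Measure (Fin n → ℝ) := Measure.pi fun _ => μ

/-- The critical value of level `α` of the test that rejects for large values of `T`: the smallest
`c` such that `T > c` has probability at most `α` under every Gaussian law with positive
variance. -/
def critValue {n : ℕ} (T : (Fin n → ℝ) → ℝ) (α : ℝ) : ℝ :=
  sInf {c : ℝ | ∀ (m : ℝ) (v : ℝ≥0), v ≠ 0 →
    sampleLaw n (gaussianReal m v) {x | c < T x} ≤ ENNReal.ofReal α}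

/-- The penalty factor `a` is admissible: under the null hypothesis, the selection rule picks
dimension `1` with probability at least `1 - α`. -/
def AdmissiblePenalty (n S : ℕ) (α a : ℝ) : Prop :=
  0 ≤ a ∧ ∀ (m : ℝ) (v : ℝ≥0), v ≠ 0 →
    ENNReal.ofReal (1 - α) ≤ sampleLaw n (gaussianReal m v) {x | selDim S a x = 1}

open Classical in
/-- The selection rule `Q̃(α)`, with penalty `a` if the oracle accepts and `1.5` if it rejects. -/
def oracleDim {n : ℕ} (S : ℕ) (α a : ℝ) (x : Fin n → ℝ) : ℕ :=
  if bcmr x ≤ critValue (bcmr (n := n)) α then selDim S a x else selDim S (3 / 2) x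

/-- The data driven test statistic. -/
def testStat {n : ℕ} (S : ℕ) (α a : ℝ) (x : Fin n → ℝ) : ℝ := chiSq x (oracleDim S α a x)

/-- The rejection region of the level `α` test rejecting for large values of the data driven
statistic. -/
def rejectionRegion (n S : ℕ) (α a : ℝ) : Set (Fin n → ℝ) :=
  {x | critValue (testStat (n := n) S α a) α < testStat S α a x}

/-- `μ` is an alternative: its distribution function is not that of the Gaussian law with the
expectation and the variance of `μ`. -/
def IsAlternative (μ : Measure ℝ) : Prop :=
  ∃ x : ℝ, cdf μ x ≠ Phi ((x - ∫ y, y ∂μ) / √(variance id μ))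

end GaussianGoF

end

namespace GaussianGoF

/-! Under the alternative the statistic grows linearly in `n`, while its critical value is `o(n)`.

Critical value: the dyadic grids are nested, so whichever dimension is selected the statistic is at
most `chiSq x (dim (S n))` (`testStat_le`). This majorant is affine invariant, so all null laws
reduce to the standard Gaussian one (`eventually_critValue_le`). There, estimating location and
scale only moves the argument `z` of the empirical distribution function by at most `η (1 + |z|)`,
and the expectation of the majorant divided by `n` is of order `D² (1/n + η²)`
(`exists_integral_majorant_le`). The factor `D²` arises from `rho p p ≥ c p (1 - p)`
(`exists_pos_mul_le_rho`). Since `D = o(√n)`, `η` fits between `n^(-1/2)` and `1/D`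
(`whp_chiSq_gaussianReal`).

Growth: the BCMR statistic divided by `n` tends in probability to `1 - c² / Var`, where `c` is the
scalar product in `L²(0,1)` of the quantile functions of `μ` and of the standard Gaussian law. A
strict Cauchy–Schwarz inequality makes this limit positive (`quantileScale_sq_lt`), so the oracle
rejects and the penalty `1.5` is in force. At one fixed grid point where the fitted Gaussian law is
wrong, the squared component is of order `n` and its penalty is bounded (`le_testStat`). -/

/-! ### The Gaussian density and distribution function. -/

lemma phi_def (x : ℝ) : phi x = (√(2 * Real.pi))⁻¹ * Real.exp (-x ^ 2 / 2) := by
  simp [phi, gaussianPDFReal_def]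

lemma phi_pos (x : ℝ) : 0 < phi x := gaussianPDFReal_pos 0 1 x one_ne_zero

lemma phi_neg (x : ℝ) : phi (-x) = phi x := by simp [phi_def]

lemma sqrt_two_pi_inv_le_one : (√(2 * Real.pi))⁻¹ ≤ 1 := by
  apply inv_le_one_of_one_le₀
  rw [Real.one_le_sqrt]
  linarith [Real.pi_gt_three]

lemma phi_le_exp (x : ℝ) : phi x ≤ Real.exp (-x ^ 2 / 2) := by
  rw [phi_def]
  exact mul_le_of_le_one_left (Real.exp_pos _).le sqrt_two_pi_inv_le_one

lemma phi_le_one (x : ℝ) : phi x ≤ 1 :=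
  (phi_le_exp x).trans (Real.exp_le_one_iff.2 (by nlinarith [sq_nonneg x]))

/-- The elementary tail bound `(1 + x²/2) φ(x) ≤ 1`. -/
lemma one_add_sq_mul_phi_le (x : ℝ) : (1 + x ^ 2 / 2) * phi x ≤ 1 := by
  have h1 : 1 + x ^ 2 / 2 ≤ Real.exp (x ^ 2 / 2) := by
    linarith [Real.add_one_le_exp (x ^ 2 / 2)]
  calc (1 + x ^ 2 / 2) * phi x
      ≤ Real.exp (x ^ 2 / 2) * Real.exp (-x ^ 2 / 2) := by
        gcongr
        · exact (phi_pos x).le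
        · exact phi_le_exp x
    _ = 1 := by rw [← Real.exp_add]; simp [neg_div]

lemma one_add_abs_mul_phi_le (x : ℝ) : (1 + |x|) * phi x ≤ 2 := by
  have h1 := one_add_sq_mul_phi_le x
  have h2 := phi_le_one x
  have h3 := phi_pos x
  have h4 : |x| ≤ 1 / 2 + x ^ 2 / 2 := by nlinarith [sq_nonneg (|x| - 1), sq_abs x]
  nlinarith

lemma hasDerivAt_phi (x : ℝ) : HasDerivAt phi (-x * phi x) x := by
  have h : phi = fun x => (√(2 * Real.pi))⁻¹ * Real.exp (-x ^ 2 / 2) := funext phi_def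
  rw [h]
  have h1 : HasDerivAt (fun x : ℝ => -x ^ 2 / 2) (-x) x := by
    have := ((hasDerivAt_id x).pow 2).neg.div_const 2
    refine this.congr_deriv ?_
    simp [neg_div]
  refine (h1.exp.const_mul _).congr_deriv ?_
  ring

lemma continuous_phi : Continuous phi :=
  continuous_iff_continuousAt.2 fun x => (hasDerivAt_phi x).continuousAt

lemma Phi_eq_integral (x : ℝ) : Phi x = ∫ y in Set.Iic x, phi y := by
  rw [Phi, cdf_eq_real, measureReal_def, gaussianReal_apply_eq_integral 0 one_ne_zero,
    ENNReal.toReal_ofReal]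
  · rfl
  · exact integral_nonneg fun y => gaussianPDFReal_nonneg 0 1 y

lemma hasDerivAt_Phi (x : ℝ) : HasDerivAt Phi (phi x) x := by
  have hint : Integrable phi := integrable_gaussianPDFReal 0 1
  have h : Phi = fun x => Phi 0 + ∫ y in (0 : ℝ)..x, phi y := by
    funext x
    rw [← intervalIntegral.integral_Iic_sub_Iic hint.integrableOn hint.integrableOn,
      ← Phi_eq_integral, ← Phi_eq_integral]
    ring
  rw [h]
  exact (intervalIntegral.integral_hasDerivAt_right (hint.intervalIntegrable)
    (continuous_phi.stronglyMeasurableAtFilter _ _) continuous_phi.continuousAt).const_add _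

lemma continuous_Phi : Continuous Phi :=
  continuous_iff_continuousAt.2 fun x => (hasDerivAt_Phi x).continuousAt

lemma tendsto_Phi_atTop : Tendsto Phi atTop (𝓝 1) := tendsto_cdf_atTop _

lemma tendsto_Phi_atBot : Tendsto Phi atBot (𝓝 0) := tendsto_cdf_atBot _

lemma strictMono_Phi : StrictMono Phi := by
  apply strictMono_of_deriv_pos
  intro x
  rw [(hasDerivAt_Phi x).deriv]
  exact phi_pos x

lemma Phi_pos (x : ℝ) : 0 < Phi x :=
  (cdf_nonneg _ _).trans_lt (strictMono_Phi (sub_one_lt x))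

lemma Phi_lt_one (x : ℝ) : Phi x < 1 :=
  (strictMono_Phi (lt_add_one x)).trans_le (cdf_le_one _ _)

lemma Phi_neg (x : ℝ) : Phi (-x) = 1 - Phi x := by
  have hd : ∀ x, HasDerivAt (fun x => Phi x + Phi (-x)) 0 x := fun x => by
    refine ((hasDerivAt_Phi x).add ((hasDerivAt_Phi (-x)).comp x (hasDerivAt_neg x))).congr_deriv ?_
    rw [phi_neg]; ring
  have hc : ∀ y, Phi x + Phi (-x) = Phi y + Phi (-y) := fun y =>
    is_const_of_deriv_eq_zero (fun x => (hd x).differentiableAt) (fun x => (hd x).deriv) x y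
  have h1 : Tendsto (fun y => Phi y + Phi (-y)) atTop (𝓝 (1 + 0)) :=
    tendsto_Phi_atTop.add (tendsto_Phi_atBot.comp tendsto_neg_atTop_atBot)
  have h2 : Tendsto (fun y => Phi y + Phi (-y)) atTop (𝓝 (Phi x + Phi (-x))) :=
    tendsto_const_nhds.congr hc
  have := tendsto_nhds_unique h1 h2
  linarith

lemma Phi_zero : Phi 0 = 1 / 2 := by
  have := Phi_neg 0
  rw [neg_zero] at this
  linarith

lemma exists_Phi_eq {p : ℝ} (h0 : 0 < p) (h1 : p < 1) : ∃ z, Phi z = p :=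
  mem_range_of_exists_le_of_exists_ge continuous_Phi
    ((tendsto_Phi_atBot.eventually (eventually_le_nhds h0)).exists)
    ((tendsto_Phi_atTop.eventually (eventually_ge_nhds h1)).exists)

lemma quantile_Phi (z : ℝ) : quantile Phi (Phi z) = z := by
  have : {x : ℝ | Phi z ≤ Phi x} = Set.Ici z := by
    ext x; simp [strictMono_Phi.le_iff_le]
  rw [quantile, this, csInf_Ici]

/-! ### Lower bound for the limit variance `rho`. -/

lemma rho_Phi (z : ℝ) :
    rho (Phi z) (Phi z) = Phi z * (1 - Phi z) - phi z ^ 2 * (1 + z ^ 2 / 2) := by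
  have h2 : (√2)⁻¹ * (√2)⁻¹ = (1 / 2 : ℝ) := by
    rw [← mul_inv, Real.mul_self_sqrt (by norm_num)]; norm_num
  rw [rho, rho₁, rho₂, quantile_Phi, min_self]
  linear_combination (-(phi z * z) ^ 2) * h2

/-- The derivative of the centred quantile defect is controlled by a positive multiple of the
centred distribution function. -/
lemma exists_pos_mul_le_defect : ∃ c : ℝ, 0 < c ∧ c < 1 ∧ ∀ z, 0 ≤ z →
    c * (2 * Phi z - 1) ≤ 2 * Phi z - 1 - (z + z ^ 3) * phi z := by
  have hu : ∀ (k z : ℝ), HasDerivAt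
      (fun z => 2 * Phi z - 1 - (z + z ^ 3) * phi z - k * (2 * Phi z - 1))
      (phi z * ((1 - z ^ 2) ^ 2 - 2 * k)) z := fun k z => by
    have e1 := ((hasDerivAt_Phi z).const_mul 2).sub_const 1
    have e2 := ((hasDerivAt_id z).add (hasDerivAt_pow 3 z)).mul (hasDerivAt_phi z)
    refine ((e1.sub e2).sub (e1.const_mul k)).congr_deriv ?_
    simp only [id, Nat.cast_ofNat, Nat.add_one_sub_one, Pi.add_apply]
    ring
  have hcont : ∀ k : ℝ, Continuous
      (fun z => 2 * Phi z - 1 - (z + z ^ 3) * phi z - k * (2 * Phi z - 1)) := fun k =>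
    continuous_iff_continuousAt.2 fun z => (hu k z).continuousAt
  have hhalf : 1 / 2 < Phi (1 / 2) := by
    have := strictMono_Phi (show (0 : ℝ) < 1 / 2 by norm_num)
    rwa [Phi_zero] at this
  -- On `[0, 1/2]` one has `(1 - z²)² ≥ 9/16 = 2 k` with `k = 9/32`. The derivative for `k = 0`
  -- vanishes at `z = 1`, so beyond `1/2` only monotonicity is used.
  have hsmall : ∀ z ∈ Set.Icc (0 : ℝ) (1 / 2),
      (9 / 32) * (2 * Phi z - 1) ≤ 2 * Phi z - 1 - (z + z ^ 3) * phi z := by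
    have hm : MonotoneOn (fun z => 2 * Phi z - 1 - (z + z ^ 3) * phi z
        - (9 / 32) * (2 * Phi z - 1)) (Set.Icc 0 (1 / 2)) := by
      apply monotoneOn_of_hasDerivWithinAt_nonneg (convex_Icc _ _) (hcont _).continuousOn
        (fun z _ => (hu _ z).hasDerivWithinAt)
      intro z hz
      rw [interior_Icc] at hz
      apply mul_nonneg (phi_pos z).le
      have : z ^ 2 ≤ 1 / 4 := by nlinarith [hz.1, hz.2]
      nlinarith
    intro z hz
    have := hm (Set.left_mem_Icc.2 (by norm_num)) hz hz.1
    simp only [Phi_zero] at this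
    linarith
  have hmono : Monotone (fun z => 2 * Phi z - 1 - (z + z ^ 3) * phi z - 0 * (2 * Phi z - 1)) := by
    apply monotone_of_hasDerivAt_nonneg (fun z => hu 0 z)
    intro z
    exact mul_nonneg (phi_pos z).le (by simpa using sq_nonneg (1 - z ^ 2))
  -- For `z ≥ 1/2` the right side is at least its value at `1/2`, which is at least `9/32 * (2
  -- Φ(1/2) - 1)`. Since `2 Φ(z) - 1 ≤ 1`, this number serves as `c`.
  refine ⟨9 / 32 * (2 * Phi (1 / 2) - 1), by nlinarith, by nlinarith [Phi_lt_one (1 / 2)],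
    fun z hz => ?_⟩
  have hz0 : 1 / 2 ≤ Phi z := by rw [← Phi_zero]; exact strictMono_Phi.monotone hz
  rcases le_total z (1 / 2) with h | h
  · refine le_trans ?_ (hsmall z ⟨hz, h⟩)
    nlinarith [Phi_lt_one (1 / 2)]
  · have h1 := hmono h
    have h2 := hsmall (1 / 2) ⟨by norm_num, le_rfl⟩
    simp only [zero_mul, sub_zero] at h1
    have h3 : 9 / 32 * (2 * Phi (1 / 2) - 1) * (2 * Phi z - 1)
        ≤ 9 / 32 * (2 * Phi (1 / 2) - 1) := by
      apply mul_le_of_le_one_right (by nlinarith)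
      linarith [Phi_lt_one z]
    linarith

/-- The limit variance of the fitted empirical process is bounded below by a multiple of that of
the Brownian bridge. -/
theorem exists_pos_mul_le_rho : ∃ c : ℝ, 0 < c ∧ ∀ p, 0 < p → p < 1 →
    c * (p * (1 - p)) ≤ rho p p := by
  obtain ⟨c, hc0, -, hc⟩ := exists_pos_mul_le_defect
  have hd : ∀ z, HasDerivAt
      (fun z => Phi z * (1 - Phi z) - phi z ^ 2 * (1 + z ^ 2 / 2) - c * (Phi z * (1 - Phi z)))
      (phi z * (c * (2 * Phi z - 1) - (2 * Phi z - 1 - (z + z ^ 3) * phi z))) z := fun z => by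
    have e1 := (hasDerivAt_Phi z).mul ((hasDerivAt_Phi z).const_sub 1)
    have e2 := ((hasDerivAt_phi z).pow 2).mul (((hasDerivAt_pow 2 z).div_const 2).const_add 1)
    refine ((e1.sub e2).sub (e1.const_mul c)).congr_deriv ?_
    simp only [Pi.pow_apply, Nat.cast_ofNat, Nat.add_one_sub_one, pow_one]
    ring
  -- The difference decreases on `[0, ∞)` and tends to `0`, hence is nonnegative there; negative
  -- arguments follow by symmetry.
  have hanti : AntitoneOn
      (fun z => Phi z * (1 - Phi z) - phi z ^ 2 * (1 + z ^ 2 / 2) - c * (Phi z * (1 - Phi z)))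
      (Set.Ici 0) := by
    apply antitoneOn_of_hasDerivWithinAt_nonpos (convex_Ici 0)
      (fun z _ => (hd z).continuousAt.continuousWithinAt) (fun z _ => (hd z).hasDerivWithinAt)
    intro z hz
    rw [interior_Ici] at hz
    exact mul_nonpos_of_nonneg_of_nonpos (phi_pos z).le (by linarith [hc z (le_of_lt hz)])
  have hlim : Tendsto
      (fun z => Phi z * (1 - Phi z) - phi z ^ 2 * (1 + z ^ 2 / 2) - c * (Phi z * (1 - Phi z)))
      atTop (𝓝 0) := by
    have h1 : Tendsto (fun z => Phi z * (1 - Phi z)) atTop (𝓝 0) := by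
      simpa using tendsto_Phi_atTop.mul (tendsto_Phi_atTop.const_sub 1)
    have hphi : Tendsto phi atTop (𝓝 0) := by
      refine squeeze_zero (fun z => (phi_pos z).le) phi_le_exp ?_
      refine Real.tendsto_exp_atBot.comp ?_
      have : Tendsto (fun z : ℝ => z ^ 2 / 2) atTop atTop :=
        (tendsto_pow_atTop two_ne_zero).atTop_div_const (by norm_num)
      refine (tendsto_neg_atTop_atBot.comp this).congr fun z => ?_
      simp [neg_div]
    have h2 : Tendsto (fun z => phi z ^ 2 * (1 + z ^ 2 / 2)) atTop (𝓝 0) := by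
      refine squeeze_zero (fun z => by positivity) (fun z => ?_) hphi
      have := one_add_sq_mul_phi_le z
      nlinarith [phi_pos z]
    simpa using (h1.sub h2).sub (h1.const_mul c)
  have hpos : ∀ z, 0 ≤ z → c * (Phi z * (1 - Phi z)) ≤ rho (Phi z) (Phi z) := fun z hz => by
    have : (0 : ℝ) ≤ Phi z * (1 - Phi z) - phi z ^ 2 * (1 + z ^ 2 / 2)
        - c * (Phi z * (1 - Phi z)) := by
      refine le_of_tendsto hlim ?_
      filter_upwards [eventually_ge_atTop z] with w hw
      exact hanti hz (hz.trans hw) hw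
    rw [rho_Phi]
    linarith
  refine ⟨c, hc0, fun p hp0 hp1 => ?_⟩
  obtain ⟨z, rfl⟩ := exists_Phi_eq hp0 hp1
  rcases le_total 0 z with hz | hz
  · exact hpos z hz
  · have := hpos (-z) (by linarith)
    rw [rho_Phi] at this ⊢
    rw [Phi_neg, phi_neg] at this
    nlinarith

/-- Between `z` and `w`, `1 + |y|` is at least half of `1 + |z|`, so `φ(y) ≤ 4 / (1 + |z|)` and the
factor `1 + |z|` cancels. Errors in location and scale thus act uniformly in `z`. -/
lemma abs_Phi_sub_le_of_le {z w h : ℝ} (h1 : h ≤ 1 / 2)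
    (hw : |w - z| ≤ h * (1 + |z|)) : |Phi w - Phi z| ≤ 4 * h := by
  have hbound : ∀ y ∈ Set.uIcc z w, ‖phi y‖ ≤ 4 / (1 + |z|) := fun y hy => by
    have hyz : |y - z| ≤ |w - z| := Set.abs_sub_left_of_mem_uIcc hy
    have h2 : |z| ≤ |y| + |y - z| := by
      have := abs_sub_abs_le_abs_sub z y
      rw [abs_sub_comm] at this; linarith
    have h3 : 1 + |z| ≤ 2 * (1 + |y|) := by nlinarith [abs_nonneg z]
    rw [Real.norm_of_nonneg (phi_pos y).le, le_div_iff₀ (by positivity)]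
    nlinarith [one_add_abs_mul_phi_le y, phi_pos y]
  have := (convex_uIcc z w).norm_image_sub_le_of_norm_hasDerivWithin_le
    (fun y _ => (hasDerivAt_Phi y).hasDerivWithinAt) hbound Set.left_mem_uIcc Set.right_mem_uIcc
  rw [Real.norm_eq_abs, Real.norm_eq_abs] at this
  refine this.trans ?_
  calc 4 / (1 + |z|) * |w - z| ≤ 4 / (1 + |z|) * (h * (1 + |z|)) := by gcongr
    _ = 4 * h := by field_simp

/-! ### Events of high probability. -/

instance isProbabilityMeasure_sampleLaw (n : ℕ) (μ : Measure ℝ) [IsProbabilityMeasure μ] :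
    IsProbabilityMeasure (sampleLaw n μ) := by
  unfold sampleLaw; infer_instance

/-- The events `A n` hold with high probability: the outer measure of their complements under
i.i.d. samples of size `n` tends to `0`. -/
def WHP (μ : Measure ℝ) (A : ∀ n : ℕ, (Fin n → ℝ) → Prop) : Prop :=
  Tendsto (fun n => sampleLaw n μ {x | ¬ A n x}) atTop (𝓝 0)

section WHP

variable {μ : Measure ℝ} {A B : ∀ n : ℕ, (Fin n → ℝ) → Prop}

lemma WHP.mono (hA : WHP μ A) (h : ∀ᶠ n in atTop, ∀ x, A n x → B n x) : WHP μ B := by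
  refine tendsto_of_tendsto_of_tendsto_of_le_of_le' tendsto_const_nhds hA
    (Eventually.of_forall fun _ => zero_le) ?_
  filter_upwards [h] with n hn
  exact measure_mono fun x hx hAx => hx (hn x hAx)

lemma WHP.and (hA : WHP μ A) (hB : WHP μ B) : WHP μ fun n x => A n x ∧ B n x := by
  have h : Tendsto (fun n => sampleLaw n μ {x | ¬ A n x} + sampleLaw n μ {x | ¬ B n x})
      atTop (𝓝 0) := by simpa using Tendsto.add hA hB
  refine tendsto_of_tendsto_of_tendsto_of_le_of_le tendsto_const_nhds h
    (fun _ => zero_le) fun n => ?_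
  refine (measure_mono fun x hx => ?_).trans (measure_union_le _ _)
  simpa only [Set.mem_union, Set.mem_ofPred_eq, not_and_or] using hx

lemma whp_of_eventually (h : ∀ᶠ n in atTop, ∀ x, A n x) : WHP μ A := by
  refine tendsto_const_nhds.congr' ?_
  filter_upwards [h] with n hn
  simp [hn]

lemma whp_forall_finset {ι : Type*} {C : ι → ∀ n : ℕ, (Fin n → ℝ) → Prop} (s : Finset ι)
    (h : ∀ i ∈ s, WHP μ (C i)) : WHP μ fun n x => ∀ i ∈ s, C i n x := by
  classical
  induction s using Finset.induction_on with
  | empty => exact whp_of_eventually (by simp)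
  | insert i s _ ih =>
    refine ((h i (by simp)).and (ih fun j hj => h j (by simp [hj]))).mono ?_
    simp

/-- Subadditivity of the outer measure bounds the probability from below, so the events need not be
measurable. -/
lemma WHP.tendsto_one [IsProbabilityMeasure μ] (hA : WHP μ A) :
    Tendsto (fun n => sampleLaw n μ {x | A n x}) atTop (𝓝 1) := by
  have h : Tendsto (fun n => 1 - sampleLaw n μ {x | ¬ A n x}) atTop (𝓝 1) := by
    simpa using ENNReal.Tendsto.sub (tendsto_const_nhds (x := (1 : ℝ≥0∞))) hA (by simp)
  refine tendsto_of_tendsto_of_tendsto_of_le_of_le h tendsto_const_nhds (fun n => ?_)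
    fun n => prob_le_one
  rw [tsub_le_iff_right, ← measure_univ (μ := sampleLaw n μ)]
  refine (measure_mono fun x _ => ?_).trans (measure_union_le _ _)
  exact em (A n x)

end WHP

/-! ### Sample averages and the weak law of large numbers. -/

/-- The average of a function over a sample. -/
noncomputable def avg {n : ℕ} (g : ℝ → ℝ) (x : Fin n → ℝ) : ℝ := (n : ℝ)⁻¹ * ∑ i, g (x i)

section Avg

variable {μ : Measure ℝ} [IsProbabilityMeasure μ] {g : ℝ → ℝ}

lemma memLp_avg (hg : MemLp g 2 μ) (n : ℕ) : MemLp (avg g) 2 (sampleLaw n μ) :=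
  (memLp_finsetSum _ fun i _ =>
    hg.comp_measurePreserving (measurePreserving_eval (fun _ : Fin n => μ) i)).const_mul _

lemma integral_avg (hg : MemLp g 2 μ) {n : ℕ} (hn : n ≠ 0) :
    ∫ x, avg g x ∂(sampleLaw n μ) = ∫ y, g y ∂μ := by
  have hi : Integrable g μ := hg.integrable one_le_two
  unfold avg sampleLaw
  rw [integral_const_mul, integral_finsetSum]
  · simp only [integral_comp_eval (μ := fun _ : Fin n => μ) (f := g) hi.aestronglyMeasurable]
    simp only [Finset.sum_const, Finset.card_univ, Fintype.card_fin, nsmul_eq_mul]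
    field_simp
  · exact fun i _ => integrable_comp_eval (μ := fun _ : Fin n => μ) (i := i) hi

lemma variance_avg (hg : MemLp g 2 μ) {n : ℕ} (hn : n ≠ 0) :
    Var[avg g; sampleLaw n μ] = Var[g; μ] / n := by
  have h : (avg g : (Fin n → ℝ) → ℝ) = fun x => (n : ℝ)⁻¹ * (∑ i, fun x : Fin n → ℝ => g (x i)) x := by
    funext x; simp [avg]
  rw [h, variance_const_mul, sampleLaw, variance_sum_pi (X := fun _ => g) fun _ => hg]
  simp only [Finset.sum_const, Finset.card_univ, Fintype.card_fin, nsmul_eq_mul]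
  field_simp

/-- The mean squared deviation of a sample average from a given constant. -/
lemma integral_avg_sub_sq (hg : MemLp g 2 μ) {n : ℕ} (hn : n ≠ 0) (b : ℝ) :
    ∫ x, (avg g x - b) ^ 2 ∂(sampleLaw n μ) = Var[g; μ] / n + (∫ y, g y ∂μ - b) ^ 2 := by
  have hm : MemLp (fun x => avg g x - b) 2 (sampleLaw n μ) := (memLp_avg hg n).sub (memLp_const b)
  have h := variance_eq_sub hm
  rw [variance_sub_const (memLp_avg hg n).aestronglyMeasurable, variance_avg hg hn, integral_sub
    ((memLp_avg hg n).integrable one_le_two) (integrable_const b), integral_avg hg hn] at h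
  simp only [integral_const, probReal_univ, smul_eq_mul, one_mul] at h
  simp only [Pi.pow_apply] at h
  linarith

/-- The weak law of large numbers with a rate. -/
theorem whp_abs_avg_sub_lt (hg : MemLp g 2 μ) {h : ℕ → ℝ} (hpos : ∀ᶠ n in atTop, 0 < h n)
    (hh : Tendsto (fun n : ℕ => n * h n ^ 2) atTop atTop) :
    WHP μ fun n x => |avg g x - ∫ y, g y ∂μ| < h n := by
  have hlim : Tendsto (fun n : ℕ => ENNReal.ofReal (Var[g; μ] / (n * h n ^ 2))) atTop (𝓝 0) := by
    simpa using ENNReal.tendsto_ofReal (hh.const_div_atTop Var[g; μ])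
  refine tendsto_of_tendsto_of_tendsto_of_le_of_le' tendsto_const_nhds hlim
    (Eventually.of_forall fun _ => zero_le) ?_
  filter_upwards [hpos, eventually_ne_atTop 0] with n hn hn0
  have := meas_ge_le_variance_div_sq (memLp_avg hg n) hn
  rw [variance_avg hg hn0, integral_avg hg hn0, div_div] at this
  simpa only [not_lt] using this

theorem whp_abs_avg_sub_lt_const (hg : MemLp g 2 μ) {ε : ℝ} (hε : 0 < ε) :
    WHP μ fun _ x => |avg g x - ∫ y, g y ∂μ| < ε :=
  whp_abs_avg_sub_lt hg (Eventually.of_forall fun _ => hε)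
    (tendsto_natCast_atTop_atTop.atTop_mul_const (by positivity))

end Avg

/-! ### Sample moments and the empirical distribution function. -/

section Statistics

variable {n : ℕ}

lemma mean_eq_avg (x : Fin n → ℝ) : mean x = avg (fun y => y) x := rfl

lemma empCDF_eq_avg (x : Fin n → ℝ) (y : ℝ) :
    empCDF x y = avg ((Set.Iic y).indicator 1) x := by
  simp [empCDF, avg, Set.indicator_apply]

lemma empCDF_mono (x : Fin n → ℝ) : Monotone (empCDF x) := by
  intro y z hyz
  unfold empCDF
  gcongr with i
  split_ifs with h1 h2
  · exact le_rfl
  · exact absurd (h1.trans hyz) h2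
  · exact zero_le_one
  · exact le_rfl

lemma sampleVar_eq (hn : n ≠ 0) (x : Fin n → ℝ) :
    sampleVar x = avg (fun y => y ^ 2) x - mean x ^ 2 := by
  have h1 : ∑ i, x i = n * mean x := by unfold mean; field_simp
  have h2 : ∀ i, (x i - mean x) ^ 2 = x i ^ 2 - 2 * mean x * x i + mean x ^ 2 := fun i => by ring
  simp only [sampleVar, avg, h2, Finset.sum_add_distrib, Finset.sum_sub_distrib,
    ← Finset.mul_sum, h1, Finset.sum_const, Finset.card_univ, Fintype.card_fin, nsmul_eq_mul]
  field_simp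
  ring

lemma sampleVar_nonneg (x : Fin n → ℝ) : 0 ≤ sampleVar x :=
  mul_nonneg (by positivity) (Finset.sum_nonneg fun _ _ => sq_nonneg _)

/-- Strict monotonicity of `Phi` removes it from the inequality. The fitted process becomes the
empirical distribution function at a random point, which monotonicity can later bracket by
deterministic ones. -/
lemma fittedCDF_Phi (x : Fin n → ℝ) (hx : 0 < sd x) (z : ℝ) :
    fittedCDF x (Phi z) = empCDF x (mean x + sd x * z) := by
  unfold fittedCDF empCDF
  congr 1
  refine Finset.sum_congr rfl fun i _ => ?_
  congr 1
  rw [strictMono_Phi.le_iff_le, div_le_iff₀ hx, sub_le_iff_le_add', mul_comm z]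

lemma abs_sd_sub_le {σ : ℝ} (hσ : 0 < σ) (x : Fin n → ℝ) :
    |sd x - σ| ≤ |sampleVar x - σ ^ 2| / σ := by
  have h0 : 0 ≤ sd x := Real.sqrt_nonneg _
  have h : sampleVar x - σ ^ 2 = (sd x - σ) * (sd x + σ) := by
    rw [← Real.sq_sqrt (sampleVar_nonneg x)]; unfold sd; ring
  rw [h, abs_mul, le_div_iff₀ hσ, abs_of_nonneg (by positivity : 0 ≤ sd x + σ)]
  gcongr
  linarith

variable {μ : Measure ℝ} [IsProbabilityMeasure μ]

lemma memLp_indicator_Iic (y : ℝ) : MemLp ((Set.Iic y).indicator (1 : ℝ → ℝ)) 2 μ :=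
  (memLp_const (1 : ℝ)).indicator measurableSet_Iic

lemma integral_indicator_Iic (y : ℝ) : ∫ t, (Set.Iic y).indicator (1 : ℝ → ℝ) t ∂μ = cdf μ y := by
  rw [integral_indicator_one measurableSet_Iic, cdf_eq_real]

lemma variance_indicator_Iic_le (y : ℝ) : Var[(Set.Iic y).indicator (1 : ℝ → ℝ); μ] ≤ 1 / 4 := by
  refine (variance_le_sq_of_bounded (a := 0) (b := 1) (ae_of_all _ fun t => ?_)
    (memLp_indicator_Iic (μ := μ) y).aestronglyMeasurable.aemeasurable).trans (by norm_num)
  by_cases h : t ∈ Set.Iic y <;> simp [h]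

lemma whp_empCDF (y : ℝ) {ε : ℝ} (hε : 0 < ε) :
    WHP μ fun _ x => |empCDF x y - cdf μ y| < ε := by
  simpa only [empCDF_eq_avg, integral_indicator_Iic] using
    whp_abs_avg_sub_lt_const (memLp_indicator_Iic (μ := μ) y) hε

lemma memLp_two_id_of_fourth (hμ : MemLp (fun y : ℝ => y ^ 2) 2 μ) :
    MemLp (fun y : ℝ => y) 2 μ := by
  rw [memLp_two_iff_integrable_sq measurable_id'.aestronglyMeasurable]
  exact hμ.integrable one_le_two

/-- Consistency of the sample mean and the sample variance. -/
lemma whp_mean_sampleVar (hμ : MemLp (fun y : ℝ => y ^ 2) 2 μ) {ε : ℝ} (hε : 0 < ε) :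
    WHP μ fun _ x => |mean x - ∫ y, y ∂μ| < ε ∧ |sampleVar x - Var[id; μ]| < ε := by
  have hid := memLp_two_id_of_fourth hμ
  have hvar : Var[id; μ] = ∫ y, y ^ 2 ∂μ - (∫ y, y ∂μ) ^ 2 := by
    simpa using variance_eq_sub (X := id) hid
  set m := ∫ y, y ∂μ
  have hc : ContinuousAt (fun y : ℝ => y ^ 2) m := by fun_prop
  obtain ⟨δ, hδ, hδ'⟩ := Metric.continuousAt_iff.1 hc (ε / 2) (by positivity)
  refine ((whp_abs_avg_sub_lt_const hid (lt_min hδ hε)).and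
    (whp_abs_avg_sub_lt_const hμ (half_pos hε))).mono ?_
  filter_upwards [eventually_ne_atTop 0] with n hn x ⟨h1, h2⟩
  rw [← mean_eq_avg] at h1
  refine ⟨h1.trans_le (min_le_right _ _), ?_⟩
  have h3 := hδ' (show dist (mean x) m < δ from h1.trans_le (min_le_left _ _))
  rw [Real.dist_eq] at h3
  rw [sampleVar_eq hn, hvar]
  rw [abs_lt] at *
  constructor <;> linarith [h2.1, h2.2, h3.1, h3.2]

end Statistics

/-! ### The quantile transform. -/

section Quantile

variable (ν : Measure ℝ)

/-- Galois connection between the quantile function and the distribution function. -/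
theorem quantile_cdf_le_iff {t : ℝ} (h0 : 0 < t) (h1 : t < 1) (y : ℝ) :
    quantile (cdf ν) t ≤ y ↔ t ≤ cdf ν y := by
  have hne : {x : ℝ | t ≤ cdf ν x}.Nonempty :=
    ((tendsto_cdf_atTop ν).eventually (eventually_ge_nhds h1)).exists
  have hbdd : BddBelow {x : ℝ | t ≤ cdf ν x} := by
    obtain ⟨b, hb⟩ := ((tendsto_cdf_atBot ν).eventually (eventually_lt_nhds h0)).exists
    exact ⟨b, fun x hx => le_of_not_gt fun hxb =>
      absurd (hx.trans (monotone_cdf ν hxb.le)) (not_le.2 hb)⟩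
  refine ⟨fun h => ?_, fun h => csInf_le hbdd h⟩
  have hmem : ∀ z, quantile (cdf ν) t < z → t ≤ cdf ν z := fun z hz => by
    obtain ⟨w, hw, hwz⟩ := exists_lt_of_csInf_lt hne hz
    exact hw.trans (monotone_cdf ν hwz.le)
  -- Right continuity passes the inequality from points above the infimum to the infimum itself.
  have hr : Tendsto (cdf ν) (𝓝[>] y) (𝓝 (cdf ν y)) :=
    ((cdf ν).right_continuous y).mono_left (nhdsWithin_mono _ Set.Ioi_subset_Ici_self)
  refine ge_of_tendsto hr ?_
  filter_upwards [self_mem_nhdsWithin] with z hz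
  exact hmem z (h.trans_lt hz)

lemma le_cdf_quantile {t : ℝ} (h0 : 0 < t) (h1 : t < 1) : t ≤ cdf ν (quantile (cdf ν) t) :=
  (quantile_cdf_le_iff ν h0 h1 _).1 le_rfl

lemma lt_quantile_cdf_iff {t : ℝ} (h0 : 0 < t) (h1 : t < 1) (y : ℝ) :
    y < quantile (cdf ν) t ↔ cdf ν y < t := by
  rw [← not_le, quantile_cdf_le_iff ν h0 h1, not_le]

lemma monotoneOn_quantile : MonotoneOn (quantile (cdf ν)) (Set.Ioo 0 1) := fun _ hs _ ht hst =>
  (quantile_cdf_le_iff ν hs.1 hs.2 _).2 (hst.trans (le_cdf_quantile ν ht.1 ht.2))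

/-- The uniform distribution on the unit interval. -/
noncomputable def unif : Measure ℝ := volume.restrict (Set.Ioo 0 1)

instance isProbabilityMeasure_unif : IsProbabilityMeasure unif := ⟨by simp [unif]⟩

instance nullSingletonClass_unif : NullSingletonClass unif :=
  inferInstanceAs (NullSingletonClass (volume.restrict (Set.Ioo (0 : ℝ) 1)))

lemma aemeasurable_quantile : AEMeasurable (quantile (cdf ν)) unif :=
  aemeasurable_restrict_of_monotoneOn measurableSet_Ioo (monotoneOn_quantile ν)

variable [IsProbabilityMeasure ν]

/-- The quantile transform. -/
theorem map_quantile : unif.map (quantile (cdf ν)) = ν := by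
  have : IsProbabilityMeasure (unif.map (quantile (cdf ν))) :=
    Measure.isProbabilityMeasure_map (aemeasurable_quantile ν)
  refine Measure.ext_of_Iic _ _ fun y => ?_
  have hset : {t | quantile (cdf ν) t ≤ y} ∩ Set.Ioo 0 1 = Set.Iic (cdf ν y) ∩ Set.Ioo 0 1 := by
    ext t
    simp only [Set.mem_inter_iff, Set.mem_ofPred_eq, Set.mem_Iic, and_congr_left_iff]
    exact fun ht => quantile_cdf_le_iff ν ht.1 ht.2 y
  rw [Measure.map_apply_of_aemeasurable (aemeasurable_quantile ν) measurableSet_Iic, unif,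
    Measure.restrict_apply' measurableSet_Ioo]
  change volume ({t | quantile (cdf ν) t ≤ y} ∩ Set.Ioo 0 1) = _
  rw [hset, ← ofReal_cdf ν y]
  -- The set lies between `Ioo 0 (cdf ν y)` and `Icc 0 (cdf ν y)`, which have equal length; this
  -- covers `cdf ν y = 1` as well.
  apply le_antisymm
  · refine (measure_mono (t := Set.Icc 0 (cdf ν y)) fun t ht => ⟨ht.2.1.le, ht.1⟩).trans ?_
    simp
  · refine le_trans ?_ (measure_mono (s := Set.Ioo 0 (cdf ν y)) fun t ht =>
      ⟨ht.2.le, ht.1, ht.2.trans_le (cdf_le_one ν y)⟩)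
    simp

lemma integral_comp_quantile {g : ℝ → ℝ} (hg : AEStronglyMeasurable g ν) :
    ∫ t, g (quantile (cdf ν) t) ∂unif = ∫ y, g y ∂ν := by
  conv_rhs => rw [← map_quantile ν]
  rw [integral_map (aemeasurable_quantile ν) (by rwa [map_quantile ν])]

lemma memLp_comp_quantile {g : ℝ → ℝ} {p : ℝ≥0∞} (hg : MemLp g p ν) :
    MemLp (fun t => g (quantile (cdf ν) t)) p unif := by
  have := (memLp_map_measure_iff (by rw [map_quantile ν]; exact hg.aestronglyMeasurable)
    (aemeasurable_quantile ν)).1 (by rwa [map_quantile ν])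
  exact this

lemma eLpNorm_quantile (p : ℝ≥0∞) :
    eLpNorm (quantile (cdf ν)) p unif = eLpNorm (fun y : ℝ => y) p ν := by
  conv_rhs => rw [← map_quantile ν]
  rw [eLpNorm_map_measure measurable_id'.aestronglyMeasurable (aemeasurable_quantile ν)]
  rfl

end Quantile

/-! ### Convergence of quantile functions. -/

section Convergence

variable {μ : Measure ℝ}

/-- Rationals suffice to separate the limit from other values. The lower bound needs no continuity;
for the upper one, continuity at `t` gives some `s > t` whose quantile is still below `y`, hence a
rational `q` with `t < cdf μ q`. -/
lemma tendsto_quantile {F : ℕ → Measure ℝ}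
    (hF : ∀ q : ℚ, Tendsto (fun k => cdf (F k) q) atTop (𝓝 (cdf μ q))) {t : ℝ}
    (ht : t ∈ Set.Ioo (0 : ℝ) 1)
    (hc : ContinuousWithinAt (quantile (cdf μ)) (Set.Ioo 0 1) t) :
    Tendsto (fun k => quantile (cdf (F k)) t) atTop (𝓝 (quantile (cdf μ) t)) := by
  rw [tendsto_order]
  constructor
  · intro y hy
    obtain ⟨q, hq1, hq2⟩ := exists_rat_btwn hy
    rw [lt_quantile_cdf_iff μ ht.1 ht.2] at hq2
    filter_upwards [(hF q).eventually (eventually_lt_nhds hq2)] with k hk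
    exact hq1.trans ((lt_quantile_cdf_iff (F k) ht.1 ht.2 _).2 hk)
  · intro y hy
    have h1 : ∀ᶠ s in 𝓝[>] t, quantile (cdf μ) s < y := by
      have : ContinuousAt (quantile (cdf μ)) t := hc.continuousAt (Ioo_mem_nhds ht.1 ht.2)
      exact (this.eventually (eventually_lt_nhds hy)).filter_mono nhdsWithin_le_nhds
    obtain ⟨s, hs, hs1⟩ := (h1.and (Ioo_mem_nhdsGT ht.2)).exists
    obtain ⟨q, hq1, hq2⟩ := exists_rat_btwn hs
    have h2 : t < cdf μ q :=
      hs1.1.trans_le ((quantile_cdf_le_iff μ (ht.1.trans hs1.1) hs1.2 _).1 hq1.le)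
    filter_upwards [(hF q).eventually (eventually_ge_nhds h2)] with k hk
    exact ((quantile_cdf_le_iff (F k) ht.1 ht.2 _).2 hk).trans_lt hq2

/-- A monotone function has countably many discontinuities, and the uniform law has no atoms. -/
lemma ae_tendsto_quantile {F : ℕ → Measure ℝ}
    (hF : ∀ q : ℚ, Tendsto (fun k => cdf (F k) q) atTop (𝓝 (cdf μ q))) :
    ∀ᵐ t ∂unif, Tendsto (fun k => quantile (cdf (F k)) t) atTop (𝓝 (quantile (cdf μ) t)) := by
  have h := (monotoneOn_quantile μ).countable_not_continuousWithinAt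
  have h2 : ∀ᵐ t ∂unif, t ∈ Set.Ioo (0 : ℝ) 1 := ae_restrict_mem measurableSet_Ioo
  have h3 := h.ae_notMem unif
  filter_upwards [h2, h3] with t ht htc
  refine tendsto_quantile hF ht ?_
  by_contra hcon
  exact htc ⟨ht, hcon⟩

/-- Convergence of distribution functions and bounded second moments give convergence of the
scalar products of the quantile functions with a fixed square integrable function. -/
theorem tendsto_integral_quantile_mul [IsProbabilityMeasure μ] {F : ℕ → Measure ℝ} [∀ k, IsProbabilityMeasure (F k)]
    (hF : ∀ q : ℚ, Tendsto (fun k => cdf (F k) q) atTop (𝓝 (cdf μ q)))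
    {B : ℝ≥0} (hB : ∀ k, eLpNorm (fun y : ℝ => y) 2 (F k) ≤ B)
    (hμ : MemLp (fun y : ℝ => y) 2 μ) {g : ℝ → ℝ} (hg : MemLp g 2 unif) :
    Tendsto (fun k => ∫ t, quantile (cdf (F k)) t * g t ∂unif) atTop
      (𝓝 (∫ t, quantile (cdf μ) t * g t ∂unif)) := by
  have hL : ∀ k, MemLp (quantile (cdf (F k))) 2 unif := fun k =>
    memLp_comp_quantile (F k) (g := fun y => y)
      ⟨measurable_id'.aestronglyMeasurable, (hB k).trans_lt ENNReal.coe_lt_top⟩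
  have hLμ : MemLp (quantile (cdf μ)) 2 unif := memLp_comp_quantile μ (g := fun y => y) hμ
  -- By Hölder, the `L¹` norm over `s` is at most `B` times the `L²` norm of `g` over `s`, which is
  -- small uniformly in `k`; Vitali's theorem then applies. Dividing by `B + 1` covers `B = 0`.
  have hui : UnifIntegrable (fun k t => quantile (cdf (F k)) t * g t) 1 unif := by
    intro ε hε
    obtain ⟨δ, hδ, h⟩ := hg.eLpNorm_indicator_le one_le_two ENNReal.ofNat_ne_top
      (show 0 < ε / (B + 1) by positivity)
    refine ⟨δ, hδ, fun k s hs hsδ => ?_⟩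
    have heq : s.indicator (fun t => quantile (cdf (F k)) t * g t)
        = quantile (cdf (F k)) • s.indicator g := by
      ext t
      by_cases ht : t ∈ s <;> simp [ht]
    rw [heq]
    calc eLpNorm (quantile (cdf (F k)) • s.indicator g) 1 unif
        ≤ eLpNorm (quantile (cdf (F k))) 2 unif * eLpNorm (s.indicator g) 2 unif :=
          eLpNorm_smul_le_mul_eLpNorm (hg.indicator hs).aestronglyMeasurable
            (hL k).aestronglyMeasurable
      _ ≤ ENNReal.ofReal (B + 1) * ENNReal.ofReal (ε / (B + 1)) := by
          gcongr
          · rw [eLpNorm_quantile]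
            refine (hB k).trans ?_
            rw [← ENNReal.ofReal_coe_nnreal]
            exact ENNReal.ofReal_le_ofReal (by linarith)
          · exact h s hs hsδ
      _ = ENNReal.ofReal ε := by
          rw [← ENNReal.ofReal_mul (by positivity)]
          congr 1
          field_simp
  have hae := ae_tendsto_quantile (μ := μ) hF
  refine tendsto_integral_of_L1' _ (hLμ.integrable_mul hg).aestronglyMeasurable
    (Eventually.of_forall fun k => (hL k).integrable_mul hg) ?_
  refine tendsto_Lp_finite_of_tendsto_ae le_rfl ENNReal.one_ne_top
    (fun k => ((hL k).integrable_mul hg).aestronglyMeasurable)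
    (memLp_one_iff_integrable.2 (hLμ.integrable_mul hg)) hui ?_
  filter_upwards [hae] with t ht
  exact ht.mul_const _

end Convergence

/-! ### The empirical measure of a sample. -/

section EmpiricalMeasure

variable {n : ℕ}

/-- The empirical measure of a sample. -/
noncomputable def empMeasure (x : Fin n → ℝ) : Measure ℝ :=
  (n : ℝ≥0∞)⁻¹ • ∑ i, Measure.dirac (x i)

lemma isProbabilityMeasure_empMeasure (hn : n ≠ 0) (x : Fin n → ℝ) :
    IsProbabilityMeasure (empMeasure x) := ⟨by
  simp only [empMeasure, Measure.smul_apply, Measure.finsetSum_apply, measure_univ,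
    Finset.sum_const, Finset.card_univ, Fintype.card_fin, smul_eq_mul, nsmul_eq_mul, mul_one]
  exact ENNReal.inv_mul_cancel (by simpa using hn) (by simp)⟩

lemma integrable_empMeasure (hn : n ≠ 0) (x : Fin n → ℝ) (g : ℝ → ℝ) :
    Integrable g (empMeasure x) :=
  (integrable_finsetSum_measure.2 fun i _ => integrable_dirac (by simp)).smul_measure
    (by simpa using hn)

lemma integral_empMeasure (x : Fin n → ℝ) (g : ℝ → ℝ) : ∫ y, g y ∂(empMeasure x) = avg g x := by
  rw [empMeasure, integral_smul_measure, integral_finsetSum_measure fun i _ => integrable_dirac (by simp)]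
  simp [avg]

lemma cdf_empMeasure (hn : n ≠ 0) (x : Fin n → ℝ) : ⇑(cdf (empMeasure x)) = empCDF x := by
  have := isProbabilityMeasure_empMeasure hn x
  funext y
  rw [← integral_indicator_Iic, integral_empMeasure, empCDF_eq_avg]

lemma memLp_id_empMeasure (hn : n ≠ 0) (x : Fin n → ℝ) :
    MemLp (fun y : ℝ => y) 2 (empMeasure x) :=
  (memLp_two_iff_integrable_sq measurable_id'.aestronglyMeasurable).2
    (integrable_empMeasure hn x _)

end EmpiricalMeasure

/-! ### The BCMR scale and its consistency. -/

lemma memLp_quantile_Phi : MemLp (quantile Phi) 2 unif :=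
  memLp_comp_quantile (gaussianReal 0 1) (g := fun y => y)
    (memLp_id_gaussianReal' 2 ENNReal.ofNat_ne_top)

lemma integral_quantile_Phi : ∫ t, quantile Phi t ∂unif = 0 :=
  (integral_comp_quantile (gaussianReal 0 1) (g := fun y => y)
    measurable_id'.aestronglyMeasurable).trans integral_id_gaussianReal

lemma integral_sq_gaussianReal : ∫ y, y ^ 2 ∂(gaussianReal 0 1) = 1 := by
  have h := variance_eq_sub (memLp_id_gaussianReal' (μ := 0) (v := 1) 2 ENNReal.ofNat_ne_top)
  rw [variance_id_gaussianReal] at h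
  simpa using h.symm

lemma integral_quantile_Phi_sq : ∫ t, quantile Phi t ^ 2 ∂unif = 1 :=
  (integral_comp_quantile (gaussianReal 0 1) (g := fun y => y ^ 2)
    (measurable_id'.pow_const 2).aestronglyMeasurable).trans integral_sq_gaussianReal

/-- The population version of `bcmrScale`. -/
noncomputable def quantileScale (μ : Measure ℝ) : ℝ :=
  ∫ t, quantile (cdf μ) t * quantile Phi t ∂unif

lemma quantileScale_gaussianReal : quantileScale (gaussianReal 0 1) = 1 := by
  rw [← integral_quantile_Phi_sq]
  exact integral_congr_ae (ae_of_all _ fun t => (sq (quantile Phi t)).symm)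

lemma bcmrScale_eq {n : ℕ} (hn : n ≠ 0) (x : Fin n → ℝ) :
    bcmrScale x = quantileScale (empMeasure x) := by
  rw [bcmrScale, quantileScale, cdf_empMeasure hn, intervalIntegral.integral_of_le zero_le_one,
    integral_Ioc_eq_integral_Ioo, unif]

section Scale

variable {μ : Measure ℝ} [IsProbabilityMeasure μ]

/-- The BCMR scale estimator depends continuously on the empirical distribution function and the
empirical second moment. -/
theorem exists_bcmrScale_close (hμ : MemLp (fun y : ℝ => y) 2 μ) {ε : ℝ} (hε : 0 < ε) :
    ∃ s : Finset ℚ, ∃ δ : ℝ, 0 < δ ∧ ∀ (n : ℕ) (x : Fin n → ℝ), n ≠ 0 →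
      (∀ q ∈ s, |empCDF x q - cdf μ q| < δ) →
      |avg (fun y => y ^ 2) x - ∫ y, y ^ 2 ∂μ| < δ → |bcmrScale x - quantileScale μ| < ε := by
  -- Compactness argument: deterministic counterexamples, tested on the first `k` rationals with
  -- tolerance `1/(k+1)`, form a sequence whose distribution functions converge at every rational
  -- and whose second moments are bounded. Their scales must then converge. Keeping only finitely
  -- many conditions lets the weak law suffice.
  by_contra! hcon
  obtain ⟨e, he⟩ := exists_surjective_nat ℚ
  choose N x hN h1 h2 h3 using fun k : ℕ =>
    hcon ((Finset.range k).image e) (1 / ((k : ℝ) + 1)) Nat.one_div_pos_of_nat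
  have hprob : ∀ k, IsProbabilityMeasure (empMeasure (x k)) := fun k =>
    isProbabilityMeasure_empMeasure (hN k) (x k)
  have hF : ∀ q : ℚ, Tendsto (fun k => cdf (empMeasure (x k)) q) atTop (𝓝 (cdf μ q)) := by
    intro q
    obtain ⟨j, rfl⟩ := he q
    rw [tendsto_iff_norm_sub_tendsto_zero]
    refine squeeze_zero' (Eventually.of_forall fun _ => norm_nonneg _) ?_
      (tendsto_one_div_add_atTop_nhds_zero_nat (𝕜 := ℝ))
    filter_upwards [eventually_gt_atTop j] with k hk
    rw [cdf_empMeasure (hN k)]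
    exact (h1 k (e j) (Finset.mem_image_of_mem e (Finset.mem_range.2 hk))).le
  have hB : ∀ k, eLpNorm (fun y : ℝ => y) 2 (empMeasure (x k))
      ≤ Real.toNNReal ((∫ y, y ^ 2 ∂μ + 1) ^ (2⁻¹ : ℝ)) := by
    intro k
    rw [(memLp_id_empMeasure (hN k) (x k)).eLpNorm_eq_integral_rpow_norm (by simp) (by simp)]
    refine ENNReal.ofReal_le_ofReal ?_
    simp only [ENNReal.toReal_ofNat, Real.rpow_ofNat, Real.norm_eq_abs, sq_abs]
    have h4 := (abs_lt.1 (h2 k)).2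
    have h5 : 1 / ((k : ℝ) + 1) ≤ 1 := by
      rw [div_le_one (by positivity)]; linarith [(Nat.cast_nonneg k : (0 : ℝ) ≤ k)]
    rw [integral_empMeasure (x k) (fun y => y ^ 2)]
    refine Real.rpow_le_rpow ?_ (by linarith) (by norm_num)
    rw [← integral_empMeasure]
    exact integral_nonneg fun y => sq_nonneg y
  have hlim := tendsto_integral_quantile_mul hF hB hμ memLp_quantile_Phi
  obtain ⟨k, hk⟩ := (hlim.eventually (Metric.ball_mem_nhds _ hε)).exists
  refine absurd hk (not_lt.2 ?_)
  have := h3 k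
  rwa [bcmrScale_eq (hN k)] at this

/-- Consistency of the BCMR scale estimator. -/
theorem whp_bcmrScale (hμ : MemLp (fun y : ℝ => y ^ 2) 2 μ) {ε : ℝ} (hε : 0 < ε) :
    WHP μ fun _ x => |bcmrScale x - quantileScale μ| < ε := by
  obtain ⟨s, δ, hδ, h⟩ := exists_bcmrScale_close (memLp_two_id_of_fourth hμ) hε
  refine ((whp_forall_finset s fun q _ => whp_empCDF (q : ℝ) hδ).and
    (whp_abs_avg_sub_lt_const hμ hδ)).mono ?_
  filter_upwards [eventually_ne_atTop 0] with n hn x hx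
  exact h n x hn hx.1 hx.2

/-- Consistency of the BCMR statistic divided by the sample size. -/
theorem whp_bcmr_ratio (hμ : MemLp (fun y : ℝ => y ^ 2) 2 μ) (hv : 0 < Var[id; μ]) {ε : ℝ}
    (hε : 0 < ε) :
    WHP μ fun _ x => |bcmrScale x ^ 2 / sampleVar x - quantileScale μ ^ 2 / Var[id; μ]| < ε := by
  have hc : ContinuousAt (fun p : ℝ × ℝ => p.1 ^ 2 / p.2) (quantileScale μ, Var[id; μ]) :=
    (continuousAt_fst.pow 2).div continuousAt_snd hv.ne'
  obtain ⟨δ, hδ, h⟩ := Metric.continuousAt_iff.1 hc ε hε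
  refine ((whp_bcmrScale hμ hδ).and (whp_mean_sampleVar hμ hδ)).mono
    (Eventually.of_forall fun n x hx => ?_)
  exact h (x := (bcmrScale x, sampleVar x)) (max_lt hx.1 hx.2.2)

end Scale

/-! ### Strict Cauchy–Schwarz inequality for alternatives. -/

section GaussianAffine

lemma map_affine_gaussianReal (m c : ℝ) :
    (gaussianReal 0 1).map (fun y => m + c * y) = gaussianReal m (c ^ 2).toNNReal := by
  have h : (fun y : ℝ => m + c * y) = (fun y => m + y) ∘ fun y => c * y := rfl
  rw [h, ← Measure.map_map (by fun_prop) (by fun_prop), gaussianReal_map_const_mul,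
    gaussianReal_map_const_add]
  congr 1
  · simp
  · ext
    rw [mul_one, Real.coe_toNNReal _ (sq_nonneg c)]
    rfl

lemma gaussianReal_eq_map (m : ℝ) (v : ℝ≥0) :
    gaussianReal m v = (gaussianReal 0 1).map fun y => m + √v * y := by
  rw [map_affine_gaussianReal, Real.sq_sqrt v.coe_nonneg, Real.toNNReal_coe]

lemma cdf_gaussianReal (m : ℝ) {v : ℝ≥0} (hv : v ≠ 0) (x : ℝ) :
    cdf (gaussianReal m v) x = Phi ((x - m) / √v) := by
  have hs : 0 < √(v : ℝ) := Real.sqrt_pos.2 (by exact_mod_cast pos_iff_ne_zero.2 hv)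
  rw [cdf_eq_real, gaussianReal_eq_map, map_measureReal_apply (by fun_prop) measurableSet_Iic,
    Phi, cdf_eq_real]
  congr 1
  ext y
  simp only [Set.mem_preimage, Set.mem_Iic]
  rw [le_div_iff₀ hs, le_sub_iff_add_le', mul_comm y]

/-- The strict Cauchy–Schwarz inequality behind the consistency of the BCMR test. -/
theorem quantileScale_sq_lt {μ : Measure ℝ} [IsProbabilityMeasure μ]
    (hμ : MemLp (fun y : ℝ => y) 2 μ) (hv : 0 < Var[id; μ]) (halt : IsAlternative μ) :
    quantileScale μ ^ 2 < Var[id; μ] := by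
  set m := ∫ y, y ∂μ with hm
  set c := quantileScale μ with hc
  have hQ : MemLp (quantile (cdf μ)) 2 unif := memLp_comp_quantile μ (g := fun y => y) hμ
  have hg := memLp_quantile_Phi
  have hR : MemLp (fun t => quantile (cdf μ) t - m - c * quantile Phi t) 2 unif :=
    (hQ.sub (memLp_const m)).sub (hg.const_mul c)
  have hQm : ∫ t, (quantile (cdf μ) t - m) ^ 2 ∂unif = Var[id; μ] := by
    rw [integral_comp_quantile μ (g := fun y => (y - m) ^ 2) (by fun_prop),
      variance_eq_integral measurable_id.aemeasurable]
    rfl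
  -- The Gaussian quantile function is centred with unit norm, so this is the squared distance from
  -- `Q - m` to its projection onto it.
  have hint : ∫ t, (quantile (cdf μ) t - m - c * quantile Phi t) ^ 2 ∂unif
      = Var[id; μ] - c ^ 2 := by
    have hexp : ∀ t, (quantile (cdf μ) t - m - c * quantile Phi t) ^ 2
        = (quantile (cdf μ) t - m) ^ 2 - 2 * c * (quantile (cdf μ) t * quantile Phi t)
          + 2 * c * m * quantile Phi t + c ^ 2 * quantile Phi t ^ 2 := fun t => by ring
    have i1 : Integrable (fun t => (quantile (cdf μ) t - m) ^ 2) unif :=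
      (hQ.sub (memLp_const m)).integrable_sq
    have i2 : Integrable (fun t => 2 * c * (quantile (cdf μ) t * quantile Phi t)) unif :=
      (hQ.integrable_mul hg).const_mul _
    have i3 : Integrable (fun t => 2 * c * m * quantile Phi t) unif :=
      (hg.integrable one_le_two).const_mul _
    have i4 : Integrable (fun t => c ^ 2 * quantile Phi t ^ 2) unif := hg.integrable_sq.const_mul _
    simp only [hexp]
    rw [integral_add (by exact (i1.sub i2).add i3) i4, integral_add (by exact i1.sub i2) i3,
      integral_sub i1 i2, hQm, integral_const_mul, integral_const_mul, integral_const_mul, integral_quantile_Phi,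
      integral_quantile_Phi_sq, ← quantileScale, ← hc]
    ring
  have hnn : 0 ≤ ∫ t, (quantile (cdf μ) t - m - c * quantile Phi t) ^ 2 ∂unif :=
    integral_nonneg fun t => sq_nonneg _
  rw [hint] at hnn
  refine lt_of_le_of_ne (by linarith) fun heq => ?_
  have hzero : (fun t => (quantile (cdf μ) t - m - c * quantile Phi t) ^ 2) =ᵐ[unif] 0 := by
    rw [← integral_eq_zero_iff_of_nonneg (fun t => sq_nonneg _) hR.integrable_sq, hint, heq, sub_self]
  have hae : quantile (cdf μ) =ᵐ[unif] fun t => m + c * quantile Phi t := by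
    filter_upwards [hzero] with t ht
    have := pow_eq_zero_iff two_ne_zero |>.1 ht
    linarith
  -- Zero distance makes `μ` the law of `m + c Z`, with `Z` standard Gaussian. Only `c²` enters that
  -- law, so the sign of `c` is irrelevant.
  have hlaw : μ = gaussianReal m (c ^ 2).toNNReal := by
    rw [← map_quantile μ, Measure.map_congr hae, ← map_affine_gaussianReal,
      ← map_quantile (gaussianReal 0 1),
      AEMeasurable.map_map_of_aemeasurable (by fun_prop) (aemeasurable_quantile _)]
    rfl
  obtain ⟨x, hx⟩ := halt
  refine hx ?_
  have hne : (c ^ 2).toNNReal ≠ 0 := (Real.toNNReal_pos.2 (heq ▸ hv)).ne'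
  have := cdf_gaussianReal m hne x
  rwa [← hlaw, Real.coe_toNNReal _ (sq_nonneg c), heq] at this

end GaussianAffine

/-! ### Affine invariance of the statistics. -/

section Affine

variable {n : ℕ} (x : Fin n → ℝ) (m : ℝ) {c : ℝ}

lemma mean_affine (hn : n ≠ 0) : mean (fun i => m + c * x i) = m + c * mean x := by
  simp only [mean, Finset.sum_add_distrib, ← Finset.mul_sum, Finset.sum_const, Finset.card_univ,
    Fintype.card_fin, nsmul_eq_mul]
  field_simp

lemma sampleVar_affine (hn : n ≠ 0) : sampleVar (fun i => m + c * x i) = c ^ 2 * sampleVar x := by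
  have h : ∀ i, (m + c * x i - (m + c * mean x)) ^ 2 = c ^ 2 * (x i - mean x) ^ 2 := fun i => by
    ring
  simp only [sampleVar, mean_affine x m hn, h, ← Finset.mul_sum]
  ring

lemma sd_affine (hn : n ≠ 0) (hc : 0 < c) : sd (fun i => m + c * x i) = c * sd x := by
  rw [sd, sampleVar_affine x m hn, Real.sqrt_mul (sq_nonneg c), Real.sqrt_sq hc.le, sd]

lemma chiSq_affine (hn : n ≠ 0) (hc : 0 < c) (d : ℕ) :
    chiSq (fun i => m + c * x i) d = chiSq x d := by
  have h : ∀ i, (m + c * x i - mean fun i => m + c * x i) / sd (fun i => m + c * x i)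
      = (x i - mean x) / sd x := fun i => by
    rw [mean_affine x m hn, sd_affine x m hn hc, add_sub_add_left_eq_sub, ← mul_sub,
      mul_div_mul_left _ _ hc.ne']
  simp only [chiSq, empCC, fittedCDF, h]

lemma empCDF_affine (hc : 0 < c) (y : ℝ) :
    empCDF (fun i => m + c * x i) y = empCDF x ((y - m) / c) := by
  unfold empCDF
  congr 1
  refine Finset.sum_congr rfl fun i _ => ?_
  congr 1
  rw [le_div_iff₀ hc, le_sub_iff_add_le', mul_comm _ c]

/-- Quantiles are affine equivariant, and the shift integrates to `0` against the centred Gaussian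
quantile function. -/
lemma bcmrScale_affine (hn : n ≠ 0) (hc : 0 < c) :
    bcmrScale (fun i => m + c * x i) = c * bcmrScale x := by
  have := isProbabilityMeasure_empMeasure hn x
  have hQ : ∀ᵐ t ∂unif, quantile (cdf (empMeasure fun i => m + c * x i)) t * quantile Phi t
      = m * quantile Phi t + c * (quantile (cdf (empMeasure x)) t * quantile Phi t) := by
    filter_upwards [ae_restrict_mem (μ := volume) (measurableSet_Ioo (a := (0 : ℝ)) (b := 1))]
      with t ht
    have hq : quantile (cdf (empMeasure fun i => m + c * x i)) t
        = m + c * quantile (cdf (empMeasure x)) t := by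
      refine eq_of_forall_ge_iff fun y => ?_
      rw [quantile_cdf_le_iff _ ht.1 ht.2, cdf_empMeasure hn, empCDF_affine x m hc,
        ← cdf_empMeasure hn, ← quantile_cdf_le_iff _ ht.1 ht.2, le_div_iff₀ hc,
        le_sub_iff_add_le', mul_comm c]
    rw [hq]
    ring
  have i1 : Integrable (fun t => m * quantile Phi t) unif :=
    (memLp_quantile_Phi.integrable one_le_two).const_mul m
  have i2 : Integrable (fun t => c * (quantile (cdf (empMeasure x)) t * quantile Phi t)) unif :=
    ((memLp_comp_quantile _ (memLp_id_empMeasure hn x)).integrable_mul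
      memLp_quantile_Phi).const_mul c
  rw [bcmrScale_eq hn, bcmrScale_eq hn, quantileScale, integral_congr_ae hQ, integral_add i1 i2,
    integral_const_mul, integral_const_mul, integral_quantile_Phi, quantileScale]
  ring

lemma bcmr_affine (hn : n ≠ 0) (hc : 0 < c) : bcmr (fun i => m + c * x i) = bcmr x := by
  rw [bcmr, bcmrScale_affine x m hn hc, sampleVar_affine x m hn, mul_pow,
    mul_div_mul_left _ _ (by positivity), bcmr]

end Affine

/-! ### Critical values under the composite null hypothesis. -/

/-- The affine map is a homeomorphism, hence a measurable embedding, so the identity holds for sets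
`A` not known to be measurable. -/
lemma sampleLaw_gaussianReal_apply (n : ℕ) (m : ℝ) {v : ℝ≥0} (hv : v ≠ 0) (A : Set (Fin n → ℝ)) :
    sampleLaw n (gaussianReal m v) A
      = sampleLaw n (gaussianReal 0 1) {x | (fun i => m + √v * x i) ∈ A} := by
  have hs : √(v : ℝ) ≠ 0 := (Real.sqrt_pos.2 (by exact_mod_cast pos_iff_ne_zero.2 hv)).ne'
  have hlaw : sampleLaw n (gaussianReal m v)
      = (sampleLaw n (gaussianReal 0 1)).map fun x i => m + √v * x i := by
    have : ∀ _ : Fin n, IsProbabilityMeasure ((gaussianReal 0 1).map fun y => m + √v * y) :=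
      fun _ => Measure.isProbabilityMeasure_map (by fun_prop)
    have h := Measure.pi_map_pi (μ := fun _ : Fin n => gaussianReal 0 1)
      (f := fun _ y => m + √v * y) (fun _ => by fun_prop)
    rw [sampleLaw, sampleLaw, h, gaussianReal_eq_map]
  have he : MeasurableEmbedding fun (x : Fin n → ℝ) i => m + √v * x i := by
    have h := (Homeomorph.piCongrRight fun _ : Fin n => affineHomeomorph (√v) m hs).measurableEmbedding
    convert h using 3 with x i
    simp [add_comm]
  rw [hlaw, he.map_apply]
  rfl

/-- Critical values are `o(n)` as soon as the statistic is dominated by an affine invariant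
statistic that is `o(n)` in probability under the standard Gaussian law. -/
theorem eventually_critValue_le {T U : ∀ n : ℕ, (Fin n → ℝ) → ℝ} (hTU : ∀ n x, T n x ≤ U n x)
    (hU : ∀ n, n ≠ 0 → ∀ (x : Fin n → ℝ) (m c : ℝ), 0 < c → U n (fun i => m + c * x i) = U n x)
    {α ε : ℝ} (hα : 0 < α) (hε : 0 ≤ ε)
    (h : WHP (gaussianReal 0 1) fun n x => U n x ≤ ε * n) :
    ∀ᶠ n in atTop, critValue (T n) α ≤ ε * n := by
  have hev := Tendsto.eventually h (eventually_le_nhds (ENNReal.ofReal_pos.2 hα))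
  filter_upwards [hev, eventually_ne_atTop 0] with n hn hn0
  unfold critValue
  set A : Set ℝ := {c : ℝ | ∀ (m : ℝ) (v : ℝ≥0), v ≠ 0 →
    sampleLaw n (gaussianReal m v) {x | c < T n x} ≤ ENNReal.ofReal α}
  have hmem : ε * n ∈ A := by
    intro m v hv
    have hs : 0 < √(v : ℝ) := Real.sqrt_pos.2 (by exact_mod_cast pos_iff_ne_zero.2 hv)
    rw [sampleLaw_gaussianReal_apply n m hv]
    refine le_trans (measure_mono fun x hx => ?_) hn
    have hx' : ε * n < T n fun i => m + √v * x i := hx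
    have := hx'.trans_le (hTU _ _)
    rw [hU n hn0 x m _ hs] at this
    exact not_le.2 this
  by_cases hb : BddBelow A
  · exact csInf_le hb hmem
  -- Here the infimum takes the default value `0`, still at most `ε * n`.
  · rw [Real.sInf_of_not_bddBelow hb]
    positivity

lemma memLp_sq_gaussianReal : MemLp (fun y : ℝ => y ^ 2) 2 (gaussianReal 0 1) := by
  rw [memLp_two_iff_integrable_sq (by fun_prop)]
  have := (memLp_id_gaussianReal' (μ := 0) (v := 1) 4 ENNReal.ofNat_ne_top).integrable_norm_pow
    (by norm_num)
  refine this.congr (ae_of_all _ fun y => ?_)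
  simp only [id, Real.norm_eq_abs]
  rw [← pow_mul]
  exact Even.pow_abs (by decide) y

/-- For the standard Gaussian law Cauchy–Schwarz is an equality: scale and variance are both `1`,
and the limiting ratio is `1`. -/
lemma whp_bcmr_gaussianReal {ε : ℝ} (hε : 0 < ε) :
    WHP (gaussianReal 0 1) fun n x => bcmr x ≤ ε * n := by
  have hv : Var[id; gaussianReal 0 1] = 1 := by rw [variance_id_gaussianReal]; rfl
  refine (whp_bcmr_ratio memLp_sq_gaussianReal (by rw [hv]; exact one_pos) hε).mono
    (Eventually.of_forall fun n x hx => ?_)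
  rw [hv, quantileScale_gaussianReal, one_pow, div_one] at hx
  rw [bcmr, mul_comm ε]
  gcongr
  linarith [(abs_lt.1 hx).1]

lemma eventually_critValue_bcmr_le {α ε : ℝ} (hα : 0 < α) (hε : 0 < ε) :
    ∀ᶠ n in atTop, critValue (bcmr (n := n)) α ≤ ε * n :=
  eventually_critValue_le (T := fun _ => bcmr) (U := fun _ => bcmr) (fun _ _ => le_rfl)
    (fun _ hn x m _ hc => bcmr_affine x m hn hc) hα hε.le (whp_bcmr_gaussianReal hε)

/-! ### The dyadic grid and the selection rule. -/

section Grid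

lemma dim_add_one (s : ℕ) : dim s + 1 = 2 ^ (s + 1) :=
  Nat.sub_add_cancel Nat.one_le_two_pow

lemma one_le_dim (s : ℕ) : 1 ≤ dim s := by
  have := dim_add_one s
  have h2 : 2 ^ 1 ≤ 2 ^ (s + 1) := Nat.pow_le_pow_right (by norm_num) (by omega)
  omega

lemma gridPoint_pos {d j : ℕ} (hj : j ∈ Finset.Icc 1 d) : 0 < gridPoint d j := by
  have : 1 ≤ j := (Finset.mem_Icc.1 hj).1
  unfold gridPoint
  positivity

lemma gridPoint_lt_one {d j : ℕ} (hj : j ∈ Finset.Icc 1 d) : gridPoint d j < 1 := by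
  have h : (j : ℝ) ≤ d := by exact_mod_cast (Finset.mem_Icc.1 hj).2
  rw [gridPoint, div_lt_one (by positivity)]
  linarith

/-- The product `j (d + 1 - j)` is smallest at the ends, where it equals `d`, and `(d + 1)² ≤ 4 d²`.
-/
lemma gridPoint_mul_one_sub {d j : ℕ} (hj : j ∈ Finset.Icc 1 d) :
    1 / (4 * (d : ℝ)) ≤ gridPoint d j * (1 - gridPoint d j) := by
  obtain ⟨h1, h2⟩ := Finset.mem_Icc.1 hj
  have h1' : (1 : ℝ) ≤ j := by exact_mod_cast h1
  have h2' : (j : ℝ) ≤ d := by exact_mod_cast h2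
  have h : gridPoint d j * (1 - gridPoint d j) = j * (d + 1 - j) / ((d : ℝ) + 1) ^ 2 := by
    unfold gridPoint
    field_simp
  rw [h, div_le_div_iff₀ (by linarith) (by positivity)]
  nlinarith [mul_nonneg (sub_nonneg.2 h1') (sub_nonneg.2 h2')]

/-- The grids are nested: point `j` of level `s` is point `2 j` of level `s + 1`, and the extra
summands are squares. -/
lemma chiSq_dim_succ {n : ℕ} (x : Fin n → ℝ) (s : ℕ) : chiSq x (dim s) ≤ chiSq x (dim (s + 1)) := by
  have hd : dim (s + 1) = 2 * dim s + 1 := by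
    have h1 := dim_add_one s
    have h2 := dim_add_one (s + 1)
    rw [pow_succ] at h2
    omega
  have hg : ∀ j, gridPoint (dim s) j = gridPoint (dim (s + 1)) (2 * j) := fun j => by
    simp only [gridPoint, hd]
    push_cast
    rw [show 2 * (dim s : ℝ) + 1 + 1 = 2 * (dim s + 1) by ring, mul_div_mul_left _ _ two_ne_zero]
  unfold chiSq
  gcongr
  have hinj : Set.InjOn (fun j : ℕ => 2 * j) (Finset.Icc 1 (dim s)) := fun a _ b _ h => by
    simpa using h
  calc ∑ j ∈ Finset.Icc 1 (dim s), empCC x (gridPoint (dim s) j) ^ 2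
      = ∑ j ∈ (Finset.Icc 1 (dim s)).image (fun j => 2 * j),
          empCC x (gridPoint (dim (s + 1)) j) ^ 2 := by
        rw [Finset.sum_image hinj]
        exact Finset.sum_congr rfl fun j _ => by rw [hg]
    _ ≤ ∑ j ∈ Finset.Icc 1 (dim (s + 1)), empCC x (gridPoint (dim (s + 1)) j) ^ 2 := by
        refine Finset.sum_le_sum_of_subset_of_nonneg ?_ fun _ _ _ => sq_nonneg _
        intro j hj
        obtain ⟨i, hi, rfl⟩ := Finset.mem_image.1 hj
        rw [Finset.mem_Icc] at hi ⊢
        omega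

lemma chiSq_dim_mono {n : ℕ} (x : Fin n → ℝ) : Monotone fun s => chiSq x (dim s) :=
  monotone_nat_of_le_succ (chiSq_dim_succ x)

lemma selDim_spec {n : ℕ} (S : ℕ) (a : ℝ) (x : Fin n → ℝ) :
    selDim S a x ∈ dims S ∧
      ∀ e ∈ dims S, chiSq x e - a * e ≤ chiSq x (selDim S a x) - a * selDim S a x := by
  have hne : {d : ℕ | d ∈ dims S ∧ ∀ e ∈ dims S,
      chiSq x e - a * e ≤ chiSq x d - a * d}.Nonempty :=
    Finset.exists_max_image (dims S) (fun d => chiSq x d - a * d) ⟨dim 0, by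
      exact Finset.mem_image_of_mem _ (by simp)⟩
  exact Nat.sInf_mem hne

/-- Either branch of the oracle selects a level at most `S`. The bound trades the selected dimension
for a fixed one. -/
lemma testStat_le {n : ℕ} (S : ℕ) (α a : ℝ) (x : Fin n → ℝ) :
    testStat S α a x ≤ chiSq x (dim S) := by
  have h : ∀ b, chiSq x (selDim S b x) ≤ chiSq x (dim S) := fun b => by
    obtain ⟨s, hs, hs'⟩ := Finset.mem_image.1 (selDim_spec S b x).1
    rw [← hs']
    exact chiSq_dim_mono x (Nat.lt_succ_iff.1 (Finset.mem_range.1 hs))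
  unfold testStat oracleDim
  split_ifs
  · exact h _
  · exact h _

end Grid

/-! ### The chi-square statistic under the null hypothesis. -/

lemma rho_pos {p : ℝ} (h0 : 0 < p) (h1 : p < 1) : 0 < rho p p := by
  obtain ⟨c, hc, h⟩ := exists_pos_mul_le_rho
  exact lt_of_lt_of_le (mul_pos hc (mul_pos h0 (sub_pos.2 h1))) (h p h0 h1)

lemma empCC_sq {n : ℕ} (x : Fin n → ℝ) {p : ℝ} (h0 : 0 < p) (h1 : p < 1) :
    empCC x p ^ 2 = (p - fittedCDF x p) ^ 2 / rho p p := by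
  rw [empCC, div_pow, Real.sq_sqrt (rho_pos h0 h1).le]

section Null

/-- The sum of the squared deviations of the empirical distribution function at the points
`z ± η (1 + |z|)` from `p = Φ(z)`. -/
noncomputable def sqDev {n : ℕ} (η z : ℝ) (x : Fin n → ℝ) : ℝ :=
  (empCDF x (z - η * (1 + |z|)) - Phi z) ^ 2 + (empCDF x (z + η * (1 + |z|)) - Phi z) ^ 2

/-- The random argument `mean x + sd x * z` lies within `η (1 + |z|)` of `z`. By monotonicity one of
the two deterministic endpoints deviates from `Φ(z)` at least as much. -/
lemma sq_sub_fittedCDF_le {n : ℕ} {x : Fin n → ℝ} {η : ℝ} (hx : 0 < sd x) (hm : |mean x| ≤ η)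
    (hs : |sd x - 1| ≤ η) (z : ℝ) : (Phi z - fittedCDF x (Phi z)) ^ 2 ≤ sqDev η z x := by
  have hz : |(sd x - 1) * z| ≤ η * |z| := by
    rw [abs_mul]
    exact mul_le_mul_of_nonneg_right hs (abs_nonneg z)
  rw [abs_le] at hm hz
  have h1 : empCDF x (z - η * (1 + |z|)) ≤ fittedCDF x (Phi z) := by
    rw [fittedCDF_Phi x hx]
    exact empCDF_mono x (by linarith [hm.1, hz.1])
  have h2 : fittedCDF x (Phi z) ≤ empCDF x (z + η * (1 + |z|)) := by
    rw [fittedCDF_Phi x hx]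
    exact empCDF_mono x (by linarith [hm.2, hz.2])
  unfold sqDev
  rcases le_total (Phi z) (fittedCDF x (Phi z)) with h | h
  · nlinarith [sq_nonneg (empCDF x (z - η * (1 + |z|)) - Phi z)]
  · nlinarith [sq_nonneg (empCDF x (z + η * (1 + |z|)) - Phi z)]

/-- Variance plus squared bias: an indicator has variance at most `1/4`, and the bias is at most `4
η` by `abs_Phi_sub_le_of_le`. -/
lemma integral_empCDF_sub_sq_le {n : ℕ} (hn : n ≠ 0) {η w z : ℝ} (h1 : η ≤ 1 / 2)
    (hw : |w - z| ≤ η * (1 + |z|)) :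
    Integrable (fun x => (empCDF x w - Phi z) ^ 2) (sampleLaw n (gaussianReal 0 1)) ∧
    ∫ x, (empCDF x w - Phi z) ^ 2 ∂(sampleLaw n (gaussianReal 0 1)) ≤ 1 / (4 * n) + 16 * η ^ 2 := by
  have hL := memLp_indicator_Iic (μ := gaussianReal 0 1) w
  have hPhi := abs_Phi_sub_le_of_le h1 hw
  simp only [empCDF_eq_avg]
  refine ⟨((memLp_avg hL n).sub (memLp_const (Phi z))).integrable_sq, ?_⟩
  rw [integral_avg_sub_sq hL hn, integral_indicator_Iic]
  have hv : Var[(Set.Iic w).indicator (1 : ℝ → ℝ); gaussianReal 0 1] / n ≤ 1 / (4 * n) := by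
    rw [← div_div]
    exact div_le_div_of_nonneg_right (variance_indicator_Iic_le w) n.cast_nonneg
  have hb : (Phi w - Phi z) ^ 2 ≤ 16 * η ^ 2 := by
    rw [← sq_abs]
    nlinarith [abs_nonneg (Phi w - Phi z)]
  exact add_le_add hv hb

lemma integral_sqDev_le {n : ℕ} (hn : n ≠ 0) {η : ℝ} (h0 : 0 ≤ η) (h1 : η ≤ 1 / 2) (z : ℝ) :
    Integrable (sqDev η z) (sampleLaw n (gaussianReal 0 1)) ∧
    ∫ x, sqDev η z x ∂(sampleLaw n (gaussianReal 0 1)) ≤ 1 / (2 * n) + 32 * η ^ 2 := by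
  have hnn : 0 ≤ η * (1 + |z|) := by positivity
  obtain ⟨i1, e1⟩ := integral_empCDF_sub_sq_le hn (w := z - η * (1 + |z|)) (z := z) h1
    (by rw [sub_sub_cancel_left, abs_neg, abs_of_nonneg hnn])
  obtain ⟨i2, e2⟩ := integral_empCDF_sub_sq_le hn (w := z + η * (1 + |z|)) (z := z) h1
    (by rw [add_sub_cancel_left, abs_of_nonneg hnn])
  refine ⟨i1.add i2, ?_⟩
  unfold sqDev
  rw [integral_add i1 i2]
  have : 1 / (2 * (n : ℝ)) = 1 / (4 * n) + 1 / (4 * n) := by field_simp; norm_num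
  linarith

/-- A nonrandom-grid majorant of the chi-square type statistic, divided by the sample size. -/
noncomputable def majorant {n : ℕ} (η : ℝ) (d : ℕ) (x : Fin n → ℝ) : ℝ :=
  ∑ j ∈ Finset.Icc 1 d, sqDev η (quantile Phi (gridPoint d j)) x
    / rho (gridPoint d j) (gridPoint d j)

lemma Phi_quantile {p : ℝ} (h0 : 0 < p) (h1 : p < 1) : Phi (quantile Phi p) = p := by
  obtain ⟨z, rfl⟩ := exists_Phi_eq h0 h1
  rw [quantile_Phi]

lemma sqDev_nonneg {n : ℕ} (η z : ℝ) (x : Fin n → ℝ) : 0 ≤ sqDev η z x := by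
  unfold sqDev; positivity

lemma majorant_nonneg {n : ℕ} (η : ℝ) (d : ℕ) (x : Fin n → ℝ) : 0 ≤ majorant η d x :=
  Finset.sum_nonneg fun _ hj =>
    div_nonneg (sqDev_nonneg _ _ _) (rho_pos (gridPoint_pos hj) (gridPoint_lt_one hj)).le

lemma chiSq_le_majorant {n : ℕ} {x : Fin n → ℝ} {η : ℝ} (hx : 0 < sd x) (hm : |mean x| ≤ η)
    (hs : |sd x - 1| ≤ η) (d : ℕ) : chiSq x d ≤ n * majorant η d x := by
  unfold chiSq majorant
  gcongr with j hj
  have h0 := gridPoint_pos hj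
  have h1 := gridPoint_lt_one hj
  rw [empCC_sq x h0 h1]
  have := sq_sub_fittedCDF_le hx hm hs (quantile Phi (gridPoint d j))
  rw [Phi_quantile h0 h1] at this
  exact div_le_div_of_nonneg_right this (rho_pos h0 h1).le

/-- On the grid `rho` is at least `c / (4 d)`, so each of the `d` summands costs a factor `4 d / c`,
whence `d²`. -/
lemma exists_integral_majorant_le : ∃ C : ℝ, 0 < C ∧ ∀ (n d : ℕ) (η : ℝ), n ≠ 0 → 0 ≤ η →
    η ≤ 1 / 2 → Integrable (majorant η d) (sampleLaw n (gaussianReal 0 1)) ∧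
    ∫ x, majorant η d x ∂(sampleLaw n (gaussianReal 0 1))
      ≤ C * d ^ 2 * (1 / (2 * n) + 32 * η ^ 2) := by
  obtain ⟨c, hc, hrho⟩ := exists_pos_mul_le_rho
  refine ⟨4 / c, by positivity, fun n d η hn h0 h1 => ?_⟩
  have hint := fun j : ℕ => integral_sqDev_le hn h0 h1 (quantile Phi (gridPoint d j))
  refine ⟨integrable_finsetSum _ fun j _ => (hint j).1.div_const _, ?_⟩
  unfold majorant
  rw [integral_finsetSum _ fun j _ => (hint j).1.div_const _]
  have hterm : ∀ j ∈ Finset.Icc 1 d, ∫ x, sqDev η (quantile Phi (gridPoint d j)) x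
      / rho (gridPoint d j) (gridPoint d j) ∂(sampleLaw n (gaussianReal 0 1))
      ≤ 4 / c * d * (1 / (2 * n) + 32 * η ^ 2) := by
    intro j hj
    have hd : (0 : ℝ) < d := by
      have := Finset.mem_Icc.1 hj
      exact_mod_cast (by omega : 0 < d)
    have hr : c / (4 * d) ≤ rho (gridPoint d j) (gridPoint d j) := by
      refine le_trans ?_ (hrho _ (gridPoint_pos hj) (gridPoint_lt_one hj))
      rw [div_eq_mul_one_div]
      exact mul_le_mul_of_nonneg_left (gridPoint_mul_one_sub hj) hc.le
    rw [integral_div, div_le_iff₀ (lt_of_lt_of_le (by positivity) hr)]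
    calc _ ≤ 1 / (2 * (n : ℝ)) + 32 * η ^ 2 := (hint j).2
      _ = 4 / c * d * (1 / (2 * n) + 32 * η ^ 2) * (c / (4 * d)) := by field_simp
      _ ≤ _ := by gcongr
  refine (Finset.sum_le_sum hterm).trans (le_of_eq ?_)
  simp only [Finset.sum_const, Nat.card_Icc, add_tsub_cancel_right, nsmul_eq_mul]
  ring

/-- Under the null hypothesis the largest chi-square type statistic is `o(n)` in probability,
provided the dimension is `o(√n)`. -/
theorem whp_chiSq_gaussianReal {D : ℕ → ℕ} (hD1 : ∀ n, 1 ≤ D n)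
    (hD : (fun n : ℕ => (D n : ℝ)) =o[atTop] fun n : ℕ => √(n : ℝ)) {ε : ℝ} (hε : 0 < ε) :
    WHP (gaussianReal 0 1) fun n x => chiSq x (D n) ≤ ε * n := by
  have hDpos : ∀ n, (0 : ℝ) < D n := fun n => by exact_mod_cast hD1 n
  have hr : Tendsto (fun n : ℕ => (D n : ℝ) / √n) atTop (𝓝 0) := hD.tendsto_div_nhds_zero
  have hrpos : ∀ᶠ n : ℕ in atTop, 0 < (D n : ℝ) / √n := by
    filter_upwards [eventually_gt_atTop 0] with n hn
    have : 0 < √(n : ℝ) := Real.sqrt_pos.2 (by exact_mod_cast hn)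
    exact div_pos (hDpos n) this
  -- the window `h n` satisfies `n * h n ^ 2 → ∞` and `D n ^ 2 * h n ^ 2 → 0`
  set h : ℕ → ℝ := fun n => √(((D n : ℝ) * √n)⁻¹) with hh
  have hsq : ∀ n, h n ^ 2 = ((D n : ℝ) * √n)⁻¹ := fun n => Real.sq_sqrt (by positivity)
  have hhpos : ∀ᶠ n in atTop, 0 < h n := by
    filter_upwards [eventually_gt_atTop 0] with n hn
    have : 0 < √(n : ℝ) := Real.sqrt_pos.2 (by exact_mod_cast hn)
    have := hDpos n
    exact Real.sqrt_pos.2 (by positivity)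
  have hnh : Tendsto (fun n : ℕ => n * h n ^ 2) atTop atTop := by
    have : Tendsto (fun n : ℕ => ((D n : ℝ) / √n)⁻¹) atTop atTop :=
      Tendsto.inv_tendsto_nhdsGT_zero (tendsto_nhdsWithin_iff.2 ⟨hr, hrpos⟩)
    refine this.congr' ?_
    filter_upwards [eventually_gt_atTop 0] with n hn
    have hs : 0 < √(n : ℝ) := Real.sqrt_pos.2 (by exact_mod_cast hn)
    have hd := hDpos n
    rw [hsq]
    nth_rewrite 2 [← Real.sq_sqrt (Nat.cast_nonneg n : (0 : ℝ) ≤ n)]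
    field_simp
  -- From `n ≥ 256` on, `h² ≤ 1/16`. Then `η = 2 h ≤ 1/2`, as the majorant bound requires, and the
  -- sample standard deviation stays positive.
  have hh0 : ∀ᶠ n in atTop, h n ≤ 1 / 4 := by
    filter_upwards [eventually_ge_atTop 256] with n hn
    have hs : 16 ≤ √(n : ℝ) := Real.le_sqrt_of_sq_le (by norm_num; exact_mod_cast hn)
    have hd : (1 : ℝ) ≤ D n := by exact_mod_cast hD1 n
    refine abs_le_of_sq_le_sq' ?_ (by norm_num) |>.2
    rw [hsq]
    refine (inv_anti₀ (by norm_num) (show (16 : ℝ) ≤ D n * √n by nlinarith)).trans (by norm_num)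
  have hev1 := whp_abs_avg_sub_lt (μ := gaussianReal 0 1)
    (memLp_id_gaussianReal' 2 ENNReal.ofNat_ne_top) hhpos hnh
  have hev2 := whp_abs_avg_sub_lt memLp_sq_gaussianReal hhpos hnh
  obtain ⟨C, hC, hmaj⟩ := exists_integral_majorant_le
  -- Markov's inequality: the expectation is of order `r² + r` with `r = D / √n`.
  have hev3 : WHP (gaussianReal 0 1) fun n x => majorant (2 * h n) (D n) x < ε := by
    have hlim : Tendsto (fun n : ℕ => ENNReal.ofReal
        (C * (D n) ^ 2 * (1 / (2 * n) + 32 * (2 * h n) ^ 2) / ε)) atTop (𝓝 0) := by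
      have h1 : Tendsto (fun n : ℕ => C / ε * (((D n : ℝ) / √n) ^ 2 / 2
          + 128 * ((D n : ℝ) / √n))) atTop (𝓝 0) := by
        simpa using (((hr.pow 2).div_const 2).add (hr.const_mul 128)).const_mul (C / ε)
      have h2 := ENNReal.tendsto_ofReal h1
      rw [ENNReal.ofReal_zero] at h2
      refine h2.congr' ?_
      filter_upwards [eventually_gt_atTop 0] with n hn
      have hs : 0 < √(n : ℝ) := Real.sqrt_pos.2 (by exact_mod_cast hn)
      have hn' : (0 : ℝ) < n := by exact_mod_cast hn
      have hd := hDpos n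
      congr 1
      rw [mul_pow, hsq, div_pow, Real.sq_sqrt hn'.le]
      field_simp
      ring
    refine tendsto_of_tendsto_of_tendsto_of_le_of_le' tendsto_const_nhds hlim
      (Eventually.of_forall fun _ => zero_le) ?_
    filter_upwards [eventually_ne_atTop 0, hhpos, hh0] with n hn h1 h2
    obtain ⟨hi, hle⟩ := hmaj n (D n) (2 * h n) hn (by linarith) (by linarith)
    have hmk := mul_meas_ge_le_integral_of_nonneg
      (ae_of_all _ fun x => majorant_nonneg (2 * h n) (D n) x) hi ε
    simp only [not_lt]
    rw [← ofReal_measureReal (measure_ne_top _ _)]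
    refine ENNReal.ofReal_le_ofReal ?_
    rw [le_div_iff₀ hε, mul_comm]
    exact hmk.trans hle
  refine ((hev1.and hev2).and hev3).mono ?_
  filter_upwards [eventually_ne_atTop 0, hhpos, hh0] with n hn h1 h2 x hx
  obtain ⟨⟨hx1, hx2⟩, hx3⟩ := hx
  have e0 : ∫ y, id y ∂(gaussianReal 0 1) = 0 := integral_id_gaussianReal
  rw [e0, sub_zero] at hx1
  rw [integral_sq_gaussianReal] at hx2
  have hmean : |mean x| < h n := hx1
  -- The second moment contributes `h` and the squared mean `h² ≤ h`, hence the window `2 h`.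
  have hvar : |sampleVar x - 1| ≤ 2 * h n := by
    rw [sampleVar_eq hn]
    rw [abs_lt] at hmean hx2
    rw [abs_le]
    constructor <;> nlinarith [hmean.1, hmean.2, hx2.1, hx2.2]
  have hsd : |sd x - 1| ≤ 2 * h n := by
    refine (abs_sd_sub_le one_pos x).trans ?_
    simpa using hvar
  have hsdpos : 0 < sd x := by linarith [(abs_le.1 hsd).1]
  refine (chiSq_le_majorant hsdpos (by linarith) hsd (D n)).trans ?_
  rw [mul_comm]
  gcongr

end Null

/-! ### Linear growth under the alternative. -/

section Alternative

variable {μ : Measure ℝ} [IsProbabilityMeasure μ]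

lemma continuous_cdf [NullSingletonClass μ] : Continuous (cdf μ) := by
  refine continuous_iff_continuousAt.2 fun y => ?_
  rw [(monotone_cdf μ).continuousAt_iff_leftLim_eq_rightLim, StieltjesFunction.rightLim_eq]
  refine le_antisymm ((monotone_cdf μ).leftLim_le le_rfl) ?_
  have h := (cdf μ).measure_singleton y
  rw [measure_cdf, measure_singleton, eq_comm, ENNReal.ofReal_eq_zero] at h
  linarith

lemma variance_id_pos [NullSingletonClass μ] (hμ : MemLp (fun y : ℝ => y) 2 μ) :
    0 < Var[id; μ] := by
  refine lt_of_le_of_ne (variance_nonneg _ _) fun h0 => ?_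
  have h1 : eVar[id; μ] = 0 := by
    rw [← MemLp.ofReal_variance_eq (X := id) hμ, ← h0, ENNReal.ofReal_zero]
  rw [evariance_eq_zero_iff measurable_id.aemeasurable] at h1
  have h2 : ∀ᵐ y ∂μ, y ≠ ∫ t, id t ∂μ := by
    simp [ae_iff]
  obtain ⟨y, hy1, hy2⟩ := (h1.and h2).exists
  exact hy2 hy1

/-- The dyadic grids are dense in the unit interval. -/
lemma exists_gridPoint_between {l u : ℝ} (hl : 0 < l) (hu : u < 1) (hlu : l < u) :
    ∃ s j, j ∈ Finset.Icc 1 (dim s) ∧ l < gridPoint (dim s) j ∧ gridPoint (dim s) j < u := by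
  obtain ⟨s, hs⟩ := pow_unbounded_of_one_lt (1 / (u - l)) (one_lt_two : (1 : ℝ) < 2)
  have hd : (dim s : ℝ) + 1 = 2 ^ (s + 1) := by exact_mod_cast dim_add_one s
  set N : ℝ := 2 ^ (s + 1) with hN
  have hNpos : 0 < N := by positivity
  have hNu : 1 < N * (u - l) := by
    rw [div_lt_iff₀ (sub_pos.2 hlu)] at hs
    have : (2 : ℝ) ^ s ≤ N := pow_le_pow_right₀ one_le_two (Nat.le_succ s)
    nlinarith [sub_pos.2 hlu]
  -- The chosen index gives the first grid point strictly above `l`; the spacing `1 / N` is less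
  -- than `u - l`.
  have hf1 : N * l < ⌊N * l⌋₊ + 1 := Nat.lt_floor_add_one _
  have hf2 : (⌊N * l⌋₊ : ℝ) ≤ N * l := Nat.floor_le (by positivity)
  have h1 : l < gridPoint (dim s) (⌊N * l⌋₊ + 1) := by
    rw [gridPoint, hd, lt_div_iff₀ hNpos]
    push_cast
    linarith
  have h2 : gridPoint (dim s) (⌊N * l⌋₊ + 1) < u := by
    rw [gridPoint, hd, div_lt_iff₀ hNpos]
    push_cast
    nlinarith
  refine ⟨s, ⌊N * l⌋₊ + 1, Finset.mem_Icc.2 ⟨by omega, ?_⟩, h1, h2⟩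
  have h3 := h2.trans hu
  rw [gridPoint, div_lt_one (by positivity)] at h3
  exact Nat.lt_succ_iff.1 (by exact_mod_cast h3)

/-- An alternative is detected by the comparison curve at some grid point. -/
lemma exists_gridPoint_cdf_ne [NullSingletonClass μ] (hv : 0 < Var[id; μ])
    (halt : IsAlternative μ) :
    ∃ s j z, j ∈ Finset.Icc 1 (dim s) ∧ Phi z = gridPoint (dim s) j ∧
      cdf μ (∫ y, y ∂μ + √Var[id; μ] * z) ≠ Phi z := by
  obtain ⟨x, hx⟩ := halt
  have hσ : 0 < √Var[id; μ] := Real.sqrt_pos.2 hv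
  set m := ∫ y, y ∂μ
  set σ := √Var[id; μ]
  set z₀ := (x - m) / σ with hz₀
  have hx' : cdf μ (m + σ * z₀) ≠ Phi z₀ := by
    rwa [hz₀, mul_div_cancel₀ _ hσ.ne', add_sub_cancel]
  have hcont : Continuous fun z => cdf μ (m + σ * z) :=
    (continuous_cdf (μ := μ)).comp (by fun_prop)
  -- By continuity the disagreement persists on an interval, whose image under `Phi` contains a
  -- dyadic point.
  have hopen : {z | cdf μ (m + σ * z) ≠ Phi z} ∈ 𝓝 z₀ :=
    (isOpen_ne_fun hcont continuous_Phi).mem_nhds hx'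
  obtain ⟨l, u, hz, hsub⟩ := mem_nhds_iff_exists_Ioo_subset.1 hopen
  obtain ⟨s, j, hj, h1, h2⟩ := exists_gridPoint_between (Phi_pos l) (Phi_lt_one u)
    (strictMono_Phi (hz.1.trans hz.2))
  obtain ⟨z, hzj⟩ := exists_Phi_eq (gridPoint_pos hj) (gridPoint_lt_one hj)
  rw [← hzj, strictMono_Phi.lt_iff_lt] at h1 h2
  exact ⟨s, j, z, hj, hzj, hsub ⟨h1, h2⟩⟩

/-- Consistency of the fitted empirical distribution function. -/
lemma whp_fittedCDF [NullSingletonClass μ] (hμ : MemLp (fun y : ℝ => y ^ 2) 2 μ)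
    (hv : 0 < Var[id; μ]) (z : ℝ) {ε : ℝ} (hε : 0 < ε) :
    WHP μ fun _ x =>
      |fittedCDF x (Phi z) - cdf μ (∫ y, y ∂μ + √Var[id; μ] * z)| < ε := by
  have hσ : 0 < √Var[id; μ] := Real.sqrt_pos.2 hv
  have hσ2 : √Var[id; μ] ^ 2 = Var[id; μ] := Real.sq_sqrt hv.le
  set m := ∫ y, y ∂μ
  set σ := √Var[id; μ]
  set w := m + σ * z with hw
  obtain ⟨η, hη, hc⟩ := Metric.continuous_iff.1 (continuous_cdf (μ := μ)) w (ε / 2) (half_pos hε)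
  have hz1 : 0 < 1 + |z| := by positivity
  -- The first bound keeps `mean x + sd x * z` within `η / 2` of `w`, the second keeps `sd x`
  -- positive.
  set δ := min (η / (2 * (1 + |z|))) (σ / 2) with hδ
  have hδ0 : 0 < δ := by positivity
  have hδz : δ * (1 + |z|) ≤ η / 2 := by
    have : δ ≤ η / (2 * (1 + |z|)) := min_le_left _ _
    rw [le_div_iff₀ (by positivity)] at this
    linarith
  have hδσ : δ ≤ σ / 2 := min_le_right _ _
  have hF : ∀ y, |y - w| ≤ η / 2 → |cdf μ y - cdf μ w| < ε / 2 := fun y hy =>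
    hc y (lt_of_le_of_lt hy (half_lt_self hη))
  have hl := hF (w - η / 2) (by rw [sub_sub_cancel_left, abs_neg, abs_of_pos (half_pos hη)])
  have hu := hF (w + η / 2) (by rw [add_sub_cancel_left, abs_of_pos (half_pos hη)])
  refine (((whp_empCDF (w - η / 2) (half_pos hε)).and (whp_empCDF (w + η / 2) (half_pos hε))).and
    (whp_mean_sampleVar hμ (lt_min hδ0 (mul_pos hδ0 hσ)))).mono
    (Eventually.of_forall fun n x hx => ?_)
  obtain ⟨⟨hx1, hx2⟩, hx3, hx4⟩ := hx
  have hm : |mean x - m| ≤ δ := (hx3.trans_le (min_le_left _ _)).le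
  have hs : |sd x - σ| ≤ δ := by
    refine (abs_sd_sub_le hσ x).trans ?_
    rw [div_le_iff₀ hσ, hσ2]
    exact (hx4.trans_le (min_le_right _ _)).le
  have hsd : 0 < sd x := by linarith [(abs_le.1 hs).1]
  have hz : |(sd x - σ) * z| ≤ δ * |z| := by
    rw [abs_mul]
    exact mul_le_mul_of_nonneg_right hs (abs_nonneg z)
  rw [abs_le] at hm hz
  have h1 : empCDF x (w - η / 2) ≤ fittedCDF x (Phi z) := by
    rw [fittedCDF_Phi x hsd]
    exact empCDF_mono x (by linarith [hm.1, hz.1])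
  have h2 : fittedCDF x (Phi z) ≤ empCDF x (w + η / 2) := by
    rw [fittedCDF_Phi x hsd]
    exact empCDF_mono x (by linarith [hm.2, hz.2])
  rw [abs_lt] at *
  constructor <;> linarith [hx1.1, hx2.2, hl.1, hu.2]

/-- Consistency of the BCMR test. -/
lemma whp_critValue_lt_bcmr (hμ : MemLp (fun y : ℝ => y ^ 2) 2 μ) (hv : 0 < Var[id; μ])
    (halt : IsAlternative μ) {α : ℝ} (hα : 0 < α) :
    WHP μ fun n x => critValue (bcmr (n := n)) α < bcmr x := by
  have hr : quantileScale μ ^ 2 / Var[id; μ] < 1 := by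
    rw [div_lt_one hv]
    exact quantileScale_sq_lt (memLp_two_id_of_fourth hμ) hv halt
  set r := quantileScale μ ^ 2 / Var[id; μ]
  -- Half of the gap `1 - r` bounds the critical value divided by `n`, the other half absorbs the
  -- sampling error.
  refine (whp_bcmr_ratio hμ hv (half_pos (sub_pos.2 hr))).mono ?_
  filter_upwards [eventually_critValue_bcmr_le hα (half_pos (sub_pos.2 hr)),
    eventually_gt_atTop 0] with n hn hn0 x hx
  refine hn.trans_lt ?_
  have hn' : (0 : ℝ) < n := by exact_mod_cast hn0
  rw [bcmr, mul_comm]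
  gcongr
  linarith [(abs_lt.1 hx).2]

/-- If the oracle rejects, the data driven statistic nearly dominates each of the squared
components of the comparison curve. -/
lemma le_testStat {n S s j : ℕ} {α a : ℝ} {x : Fin n → ℝ}
    (hx : critValue (bcmr (n := n)) α < bcmr x) (hs : s ≤ S) (hj : j ∈ Finset.Icc 1 (dim s)) :
    n * empCC x (gridPoint (dim s) j) ^ 2 - 3 / 2 * dim s ≤ testStat S α a x := by
  rw [testStat, oracleDim, if_neg (not_le.2 hx)]
  have h1 := (selDim_spec S (3 / 2) x).2 (dim s)
    (Finset.mem_image_of_mem _ (Finset.mem_range.2 (Nat.lt_succ_of_le hs)))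
  have h2 : n * empCC x (gridPoint (dim s) j) ^ 2 ≤ chiSq x (dim s) := by
    unfold chiSq
    gcongr
    exact Finset.single_le_sum (f := fun j => empCC x (gridPoint (dim s) j) ^ 2)
      (fun _ _ => sq_nonneg _) hj
  have h3 : (0 : ℝ) ≤ selDim S (3 / 2) x := Nat.cast_nonneg _
  linarith

/-- Under an alternative the data driven statistic grows at least linearly in the sample size. -/
theorem exists_whp_mul_lt_testStat [NullSingletonClass μ]
    (hμ : MemLp (fun y : ℝ => y ^ 2) 2 μ) (halt : IsAlternative μ) {α : ℝ} (hα : 0 < α)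
    {S : ℕ → ℕ} (hS : Tendsto S atTop atTop) (a : ℕ → ℝ) :
    ∃ ε : ℝ, 0 < ε ∧ WHP μ fun n x => ε * n < testStat (S n) α (a n) x := by
  have hv := variance_id_pos (memLp_two_id_of_fourth hμ)
  obtain ⟨s, j, z, hj, hzj, hne⟩ := exists_gridPoint_cdf_ne hv halt
  have h0 := gridPoint_pos hj
  have h1 := gridPoint_lt_one hj
  have hρ := rho_pos h0 h1
  set F := cdf μ (∫ y, y ∂μ + √Var[id; μ] * z)
  set κ := |F - Phi z| / 2 with hκ
  have hκ0 : 0 < κ := half_pos (abs_pos.2 (sub_ne_zero.2 hne))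
  set ρ := rho (gridPoint (dim s) j) (gridPoint (dim s) j)
  -- The squared component is at least `κ² / ρ`; half of this rate is given up to absorb the penalty
  -- `3/2 * dim s`, which does not depend on `n`.
  refine ⟨κ ^ 2 / ρ / 2, by positivity, ?_⟩
  refine ((whp_critValue_lt_bcmr hμ hv halt hα).and (whp_fittedCDF hμ hv z hκ0)).mono ?_
  have hlarge : ∀ᶠ n : ℕ in atTop, 3 / 2 * (dim s : ℝ) < κ ^ 2 / ρ / 2 * n :=
    (tendsto_natCast_atTop_atTop.const_mul_atTop (by positivity)).eventually_gt_atTop _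
  filter_upwards [hS.eventually_ge_atTop s, hlarge] with n hn hn2 x hx
  have hstat := le_testStat (a := a n) hx.1 hn hj
  have hdev : κ ≤ |gridPoint (dim s) j - fittedCDF x (gridPoint (dim s) j)| := by
    rw [← hzj, abs_sub_comm]
    have := abs_sub_le F (fittedCDF x (Phi z)) (Phi z)
    rw [abs_sub_comm F (fittedCDF x (Phi z))] at this
    linarith [hx.2]
  have hcc : κ ^ 2 / ρ ≤ empCC x (gridPoint (dim s) j) ^ 2 := by
    rw [empCC_sq x h0 h1, ← sq_abs (gridPoint (dim s) j - _)]
    gcongr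
  have := mul_le_mul_of_nonneg_left hcc (Nat.cast_nonneg n : (0 : ℝ) ≤ n)
  linarith

end Alternative

end GaussianGoF

/-! ### Conclusion. -/

theorem proposition2
    (α : ℝ) (hα0 : 0 < α) (hα1 : α < 1)
    (μ : Measure ℝ) [IsProbabilityMeasure μ]
    (hmoment : Integrable (fun x : ℝ => x ^ 4) μ)
    (f : ℝ → ℝ) (hf_meas : Measurable f) (hf_nonneg : ∀ x, 0 ≤ f x)
    (hf_bdd : ∃ C : ℝ, ∀ x, f x ≤ C)
    (hf : μ = volume.withDensity fun x => ENNReal.ofReal (f x))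
    (halt : GaussianGoF.IsAlternative μ)
    (S : ℕ → ℕ) (hS : Tendsto S atTop atTop)
    (hD : (fun n : ℕ => (GaussianGoF.dim (S n) : ℝ)) =o[atTop] fun n : ℕ => √(n : ℝ))
    (a : ℕ → ℝ) (ha : ∀ n, 2 ≤ n → GaussianGoF.AdmissiblePenalty n (S n) α (a n)) :
    Tendsto
      (fun n => GaussianGoF.sampleLaw n μ (GaussianGoF.rejectionRegion n (S n) α (a n)))
      atTop (𝓝 1) := by
  have hμ : MemLp (fun y : ℝ => y ^ 2) 2 μ := by
    rw [memLp_two_iff_integrable_sq (by fun_prop)]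
    exact hmoment.congr (ae_of_all _ fun y => by ring)
  have hatom : NullSingletonClass μ := by
    rw [hf]
    infer_instance
  obtain ⟨ε, hε, halt'⟩ := GaussianGoF.exists_whp_mul_lt_testStat hμ halt hα0 hS a
  -- The null bound holds for every positive rate, so it may be taken equal to the growth rate `ε`
  -- of the alternative.
  have hcrit := GaussianGoF.eventually_critValue_le
    (T := fun n => GaussianGoF.testStat (S n) α (a n))
    (U := fun n x => GaussianGoF.chiSq x (GaussianGoF.dim (S n)))
    (fun n x => GaussianGoF.testStat_le (S n) α (a n) x)
    (fun n hn x m c hc => GaussianGoF.chiSq_affine x m hn hc _) hα0 hε.le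
    (GaussianGoF.whp_chiSq_gaussianReal (fun n => GaussianGoF.one_le_dim (S n)) hD hε)
  exact (halt'.mono (hcrit.mono fun n hn x hx => hn.trans_lt hx)).tendsto_one
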